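/- Let $d\ge 1$, let $\mu$ be Lebesgue measure on $Z=\mathbb{R}^d$, let $(\mathscr{A},\varphi)$ be a unital $*$-algebra over $\mathbb{C}$ with a faithful tracial state, and let $N$ be a free Poisson random measure on $Z$ with control $\mu$ and values in $(\mathscr{A},\varphi)$. That is, for Borel sets of finite measure, $N(A)$ is a positive element of $\mathscr{A}$ with the free Poisson law of rate $\mu(A)$, $N(A_1),\dots,N(A_r)$ are free whenever $A_1,\dots,A_r$ are disjoint, and in that case $N(A_1\cup\dots\cup A_r)=N(A_1)+\dots+N(A_r)$. Here the free Poisson law of rate $\lambda\ge 0$ is $\max(1-\lambda,0)\,\delta_0+\frac{1}{2\pi x}\sqrt{4\lambda-(x-1-\lambda)^2}\,dx$, the density being carried by $\big((1-\sqrt\lambda)^2,(1+\sqrt\lambda)^2\big)$. Put $\hat N(A)=N(A)-\mu(A)1$, let $L^2(\mathscr{A},\varphi)$ be the completion of $\mathscr{A}$ for $\|a\|_2=\varphi(a^*a)^{1/2}$, and let $I_1^{\hat N}(f)\in L^2(\mathscr{A},\varphi)$, for $f\in L^2(Z;\mathbb{C})$, be the $L^2$-continuous linear extension of $\mathbf 1_A\mapsto\hat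 N(A)$ ($A$ bounded Borel). Call $f\in L^2(Z)$ a bounded kernel if it is (a.e.) bounded with bounded support; the adjoint is $f^*=\overline f$. If $f=f^*$ is a bounded kernel, then $I_1^{\hat N}(f)$ is well defined and is a bounded element, i.e. left multiplication by it is a bounded operator $T$ on $L^2(\mathscr{A},\varphi)$; its moments are $\varphi(I_1^{\hat N}(f)^m)=\langle 1,T^m1\rangle$. Let $\mathcal{S}(0,t)$ be the centered semicircular law, with density $(2\pi t)^{-1}\sqrt{4t-x^2}$ on $|x|<2\sqrt t$ for $t>0$, and $\mathcal{S}(0,0)=\delta_0$. Convergence in law means convergence of $\varphi(P(\cdot))$ for every real polynomial $P$. Then: (i) If $f\ne 0$ is a bounded kernel with $f=f^*$, then the law of $I_1^{\hat N}(f)$ is not $\mathcal{S}(0,t)$ for any $t\ge 0$. (ii) Let $\alpha\in\mathbb{R}$ and let $(f_n)$ be bounded kernels such that $f_n=f_n^*$, $\|f_n\|^2_{L^2(Z)}\to\alpha^2$ and $\sup_n\int_Z|f_n|^p\,d\mu<\infty$ for every integer $p\ge 2$. Then $I_1^{\hat N}(f_n)$ converges in law to $\mathcal{S}(0,\alpha^2)$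 if and only if $\int_Z f_n^4\,d\mu\to 0$. -/

import Mathlib

open MeasureTheory Filter Topology Polynomial
open scoped ComplexOrder InnerProductSpace

namespace FreeProb

noncomputable section

/-! ### Tracial noncommutative probability spaces -/

/-- A faithful tracial state on a unital `*`-algebra over `ℂ`. -/
structure TracialState (A : Type*) [Ring A] [StarRing A] [Algebra ℂ A] [StarModule ℂ A] where
  toLinearMap : A →ₗ[ℂ] ℂ
  map_one' : toLinearMap 1 = 1
  nonneg' : ∀ a : A, 0 ≤ toLinearMap (star a * a)
  faithful' : ∀ a : A, toLinearMap (star a * a) = 0 → a = 0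
  tracial' : ∀ a b : A, toLinearMap (a * b) = toLinearMap (b * a)

variable {A : Type*} [Ring A] [StarRing A] [Algebra ℂ A] [StarModule ℂ A]

instance : CoeFun (TracialState A) (fun _ => A → ℂ) := ⟨fun φ => φ.toLinearMap⟩

/-- A positive functional is Hermitian. -/
theorem TracialState.map_star (φ : TracialState A) (a : A) :
    φ (star a) = (starRingEnd ℂ) (φ a) := by
  have im0 : ∀ b : A, (φ.toLinearMap (star b * b)).im = 0 := fun b =>
    ((Complex.le_def.mp (φ.nonneg' b)).2).symm
  have h0 := im0 a
  have h1 := im0 (a + 1)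
  have h2 := im0 (a + Complex.I • (1 : A))
  have e1 := im0 1
  simp only [star_add, star_one, add_mul, mul_add, one_mul, mul_one, map_add, star_smul,
    smul_mul_assoc, mul_smul_comm, map_smul, Complex.add_im, smul_eq_mul, Complex.star_def,
    Complex.conj_I, Complex.mul_im, Complex.neg_im, Complex.neg_re, Complex.I_re,
    Complex.I_im, φ.map_one', Complex.one_im] at h0 h1 h2 e1
  apply Complex.ext
  · simp only [Complex.conj_re]; linarith
  · simp only [Complex.conj_im]; linarith

/-! ### The Hilbert space `L²(A, φ)` -/

/-- The algebra `A`, to be given the inner product `⟪a, b⟫ = φ (a* b)`. -/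
def PreL2 (_φ : TracialState A) : Type _ := A

instance (φ : TracialState A) : AddCommGroup (PreL2 φ) := inferInstanceAs (AddCommGroup A)
instance (φ : TracialState A) : Module ℂ (PreL2 φ) := inferInstanceAs (Module ℂ A)

/-- The identity map from `A` to `PreL2 φ`. -/
def toPreL2 (φ : TracialState A) : A ≃ₗ[ℂ] PreL2 φ := LinearEquiv.refl ℂ _

/-- The inner product `⟪a, b⟫ = φ (a* b)`, conjugate-linear in the first variable. -/
abbrev preL2Core (φ : TracialState A) : PreInnerProductSpace.Core ℂ (PreL2 φ) where
  inner a b := φ (star ((toPreL2 φ).symm a) * (toPreL2 φ).symm b)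
  conj_inner_symm a b := by rw [← φ.map_star]; simp
  re_inner_nonneg a := (Complex.le_def.mp (φ.nonneg' ((toPreL2 φ).symm a))).1
  add_left a b c := by rw [map_add, star_add, add_mul, map_add]
  smul_left a b r := by simp

instance (φ : TracialState A) : SeminormedAddCommGroup (PreL2 φ) :=
  InnerProductSpace.Core.toSeminormedAddCommGroup (c := preL2Core φ)
instance (φ : TracialState A) : InnerProductSpace ℂ (PreL2 φ) :=
  InnerProductSpace.ofCore (preL2Core φ)

/-- `L²(A, φ)`: the completion of `A` for the norm `‖a‖₂ = φ (a* a) ^ (1/2)`. -/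
abbrev L2 (φ : TracialState A) : Type _ := UniformSpace.Completion (PreL2 φ)

/-- The canonical map `A → L²(A, φ)`. -/
def ofAlg (φ : TracialState A) (a : A) : L2 φ := ((toPreL2 φ a : PreL2 φ) : L2 φ)

theorem inner_ofAlg (φ : TracialState A) (a b : A) :
    ⟪ofAlg φ a, ofAlg φ b⟫_ℂ = φ (star a * b) :=
  UniformSpace.Completion.inner_coe _ _

/-! ### Bounded elements of `L²(A, φ)` and their laws -/

/-- `T` is the bounded operator on `L²(A, φ)` of left multiplication by `ξ`. The product `ξ a` is
expressed weakly: since `φ` is a trace, `⟪b, ξ a⟫ = φ (b* ξ a) = φ ((b a*)* ξ) = ⟪b a*, ξ⟫`. -/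
def IsLeftMul (φ : TracialState A) (ξ : L2 φ) (T : L2 φ →L[ℂ] L2 φ) : Prop :=
  ∀ a b : A, ⟪ofAlg φ b, T (ofAlg φ a)⟫_ℂ = ⟪ofAlg φ (b * star a), ξ⟫_ℂ

/-- `ξ` is a bounded element of `L²(A, φ)`: left multiplication by `ξ` is a bounded operator. -/
def IsBoundedElement (φ : TracialState A) (ξ : L2 φ) : Prop :=
  ∃ T : L2 φ →L[ℂ] L2 φ, IsLeftMul φ ξ T

theorem denseRange_ofAlg (φ : TracialState A) : DenseRange (ofAlg φ) :=
  UniformSpace.Completion.denseRange_coe.comp (toPreL2 φ).surjective.denseRange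
    (UniformSpace.Completion.continuous_coe _)

/-- The operator of left multiplication by a bounded element is unique. -/
theorem IsLeftMul.unique {φ : TracialState A} {ξ : L2 φ} {S T : L2 φ →L[ℂ] L2 φ}
    (hS : IsLeftMul φ ξ S) (hT : IsLeftMul φ ξ T) : S = T := by
  apply ContinuousLinearMap.coeFn_injective
  refine (denseRange_ofAlg φ).equalizer S.continuous T.continuous (funext fun a => ?_)
  refine (denseRange_ofAlg φ).eq_of_inner_right (𝕜 := ℂ) ?_
  exact fun b => (hS a b).trans (hT a b).symm

open Classical in
/-- Left multiplication by a bounded element `ξ` (and `0` when `ξ` is not bounded). -/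
def leftMul (φ : TracialState A) (ξ : L2 φ) : L2 φ →L[ℂ] L2 φ :=
  if h : IsBoundedElement φ ξ then h.choose else 0

/-- The number `φ (P (a))`, for `a ∈ A` and a real polynomial `P`. -/
def polyMoment (φ : TracialState A) (a : A) (P : ℝ[X]) : ℂ :=
  φ (aeval a (P.map (algebraMap ℝ ℂ)))

/-- The number `φ (P (ξ))`, for a bounded element `ξ` of `L²(A, φ)` and a real polynomial `P`;
the trace is extended to bounded elements by `φ (T) = ⟪1, T 1⟫`. -/
def polyMomentL2 (φ : TracialState A) (ξ : L2 φ) (P : ℝ[X]) : ℂ :=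
  ⟪ofAlg φ 1, aeval (leftMul φ ξ) (P.map (algebraMap ℝ ℂ)) (ofAlg φ 1)⟫_ℂ

/-- `ν` is the law of a bounded random variable with polynomial moments `P ↦ D P`: the compactly
supported probability measure on `ℝ` with `∫ P dν = D P` for every real polynomial `P`. -/
def IsLawOf (D : ℝ[X] → ℂ) (ν : Measure ℝ) : Prop :=
  IsProbabilityMeasure ν ∧ (∃ R : ℝ, ∀ᵐ x ∂ν, |x| ≤ R) ∧
    ∀ P : ℝ[X], D P = ((∫ x, P.eval x ∂ν : ℝ) : ℂ)

/-- Convergence in law (convergence of all polynomial moments) to a random variable of law `ν`. -/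
def ConvergesInLaw (D : ℕ → ℝ[X] → ℂ) (ν : Measure ℝ) : Prop :=
  ∀ P : ℝ[X], Tendsto (fun n => D n P) atTop (𝓝 ((∫ x, P.eval x ∂ν : ℝ) : ℂ))

/-! ### The semicircular and the free Poisson distributions -/

open Classical in
/-- The centered semicircular distribution of parameter `t`, with density
`√(4 t - x²) / (2 π t)` on `|x| < 2 √t` if `t > 0`; for `t = 0` it is the Dirac mass at `0`.
(`Real.sqrt` vanishes at negative numbers.) -/
def semicircular (t : ℝ) : Measure ℝ :=
  if t = 0 then Measure.dirac 0
  else volume.withDensity fun x => ENNReal.ofReal ((2 * Real.pi * t)⁻¹ * √(4 * t - x ^ 2))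

/-- The free Poisson (Marchenko-Pastur) distribution of rate `r ≥ 0`: an absolutely continuous part
with density `√(4 r - (x - 1 - r)²) / (2 π x)` on `((1 - √r)², (1 + √r)²)`, together with an atom of
mass `1 - r` at `0` when `r < 1`. -/
def freePoisson (r : ℝ) : Measure ℝ :=
  ENNReal.ofReal (1 - r) • Measure.dirac 0 +
    volume.withDensity fun x =>
      ENNReal.ofReal ((2 * Real.pi * x)⁻¹ * √(4 * r - (x - 1 - r) ^ 2))

/-! ### Free independence and free Poisson random measures -/

/-- Freeness of a family of unital subalgebras: an alternating product of centered elements is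
centered. -/
def AreFree (φ : TracialState A) {ι : Type*} (B : ι → Subalgebra ℂ A) : Prop :=
  ∀ (m : ℕ) (i : Fin (m + 1) → ι) (x : Fin (m + 1) → A),
    (∀ j, x j ∈ B (i j)) →
    (∀ j : Fin m, i j.castSucc ≠ i j.succ) →
    (∀ j, φ (x j) = 0) →
    φ ((List.ofFn x).prod) = 0

/-- `N` is a free Poisson random measure with control `μ` and values in `(A, φ)`. Only the values
of `N` at measurable sets of finite measure are relevant. -/
structure IsFreePoissonMeasure (φ : TracialState A) {Z : Type*} [MeasurableSpace Z]
    (μ : Measure Z) (N : Set Z → A) : Prop where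
  positive : ∀ B, MeasurableSet B → μ B < ⊤ →
    N B ∈ AddSubmonoid.closure (Set.range fun a : A => star a * a)
  law : ∀ B, MeasurableSet B → μ B < ⊤ →
    IsLawOf (polyMoment φ (N B)) (freePoisson (μ B).toReal)
  free : ∀ (r : ℕ) (B : Fin r → Set Z), (∀ j, MeasurableSet (B j)) → (∀ j, μ (B j) < ⊤) →
    Pairwise (fun j k => Disjoint (B j) (B k)) →
    AreFree φ (fun j => Algebra.adjoin ℂ {N (B j)})
  additive : ∀ (r : ℕ) (B : Fin r → Set Z), (∀ j, MeasurableSet (B j)) → (∀ j, μ (B j) < ⊤) →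
    Pairwise (fun j k => Disjoint (B j) (B k)) →
    N (⋃ j, B j) = ∑ j, N (B j)

/-! ### Single free Poisson integrals -/

/-- The space `Z = ℝ^d`, with Lebesgue measure. -/
abbrev Z (d : ℕ) : Type := EuclideanSpace ℝ (Fin d)

/-- Bounded Borel sets of `ℝ^d`. -/
abbrev BoundedBorel (d : ℕ) : Type := {B : Set (Z d) // MeasurableSet B ∧ Bornology.IsBounded B}

/-- (Formal) elementary kernels: finite complex combinations `∑ c_j 1_{B_j}` of indicators of
bounded Borel sets. -/
abbrev Elementary (d : ℕ) : Type := BoundedBorel d →₀ ℂ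

/-- The element `∑ c_j 1_{B_j}` of `L²(ℝ^d)`. -/
def Elementary.toLp {d : ℕ} : Elementary d →ₗ[ℂ] Lp ℂ 2 (volume : Measure (Z d)) :=
  Finsupp.linearCombination ℂ fun B : BoundedBorel d =>
    indicatorConstLp 2 B.2.1 B.2.2.measure_lt_top.ne (1 : ℂ)

/-- The centered measure `N̂ (B) = N (B) - μ (B) 1`. -/
def centered {d : ℕ} (N : Set (Z d) → A) (B : Set (Z d)) : A :=
  N B - ((volume B).toReal : ℂ) • (1 : A)

/-- The single integral `∑ c_j N̂ (B_j)` of an elementary kernel. -/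
def elementaryIntegral {d : ℕ} (N : Set (Z d) → A) : Elementary d →ₗ[ℂ] A :=
  Finsupp.linearCombination ℂ fun B : BoundedBorel d => centered N B.1

/-- The single integral of `f ∈ L²(ℝ^d)` with respect to `N̂`: the limit in `L²(A, φ)` of the
integrals of elementary kernels `h` as `h → f` in `L²(ℝ^d)`. -/
def integral {d : ℕ} (φ : TracialState A) (N : Set (Z d) → A)
    (f : Lp ℂ 2 (volume : Measure (Z d))) : L2 φ :=
  limUnder (comap (Elementary.toLp (d := d)) (𝓝 f)) fun h => ofAlg φ (elementaryIntegral N h)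

/-- `f` is bounded with bounded support. -/
def IsBoundedKernel {d : ℕ} (f : Lp ℂ 2 (volume : Measure (Z d))) : Prop :=
  (∃ C : ℝ, ∀ᵐ x, ‖f x‖ ≤ C) ∧ ∃ R : ℝ, ∀ᵐ x, R < ‖x‖ → f x = 0

/-- `f = f*`, where `f* (t)` is the complex conjugate of `f (t)` for kernels of one variable. -/
def IsMirrorSymmetric {d : ℕ} (f : Lp ℂ 2 (volume : Measure (Z d))) : Prop :=
  ∀ᵐ x, f x = (starRingEnd ℂ) (f x)

end

end FreeProb

namespace FreeProb

noncomputable section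

/-! ### Polynomials attached to a sequence of free cumulants -/

/-! The proof runs on free cumulants, encoded without partitions. If `K(z) = 1/z + ∑ κ n z ^ (n -
1)` inverts the Cauchy transform of a centered law, then `z (K(z) - X) = 1 - z X + ∑ κ n z ^ n`, and
its reciprocal has mean `1`. Hence a functional has cumulants `κ` exactly when it kills every
positive-degree coefficient of this reciprocal, that is `cumPoly κ n` for `n ≥ 1`. These polynomials
are monic of degree `n`, so the condition determines the moments recursively, and continuously in
`κ` (`tendsto_of_tendsto_cumulants`).

Cumulants add over free elements (`map_evalAt_cumPoly_sum`), and those of `c N̂(B)` are `μ(B) c ^ m`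
for `m ≥ 2` (`IsLawOf.cumPoly_freePoisson`). A real step kernel `f` thus gives an integral with
cumulants `∫ f ^ m`. To reach all bounded real kernels, operator norms of the approximants must be
bounded uniformly. This comes from the positivity of `N` (`exists_bound_stepKernel`), the norm of a
single `N(S)` being read off its moments by `norm_mul_le_of_moments`. `L²` convergence then becomes
convergence of moments, which yields `integral_spec`.

The conclusion is about the fourth cumulant. For a centered law the fourth moment is `2 κ₂² + κ₄`,
and `κ₄ = ∫ f⁴` here, while a semicircular law has only `κ₂`. So equality with a semicircular law
forces `∫ f⁴ = 0`, hence `f = 0`, and convergence to one forces `∫ f_n⁴ → 0`. Conversely,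
Cauchy-Schwarz bounds every cumulant of order at least `3` by `√(∫ f⁴)` times a bounded factor
(`abs_kernelCumulant_le`), so all cumulants converge to the semicircular ones. -/

/-- The power series `1 - z X + ∑_{n ≥ 2} κ n z ^ n`. -/
def cumDen (κ : ℕ → ℝ) : PowerSeries ℝ[X] :=
  PowerSeries.mk fun n => if n = 0 then 1 else if n = 1 then -X else C (κ n)

/-- The inverse of `cumDen κ`. -/
def cumGen (κ : ℕ → ℝ) : PowerSeries ℝ[X] := (cumDen κ).invOfUnit 1

/-- The coefficients of `(1 - z X + ∑_{n ≥ 2} κ n z ^ n)⁻¹`. A centered law with free cumulants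
`κ` annihilates them for `n ≥ 1`. -/
def cumPoly (κ : ℕ → ℝ) (n : ℕ) : ℝ[X] := PowerSeries.coeff n (cumGen κ)

theorem cumDen_mul_cumGen (κ : ℕ → ℝ) : cumDen κ * cumGen κ = 1 :=
  PowerSeries.mul_invOfUnit _ _ (by
    rw [← PowerSeries.coeff_zero_eq_constantCoeff_apply]; simp [cumDen])

theorem cumPoly_zero (κ : ℕ → ℝ) : cumPoly κ 0 = 1 := by
  simp [cumPoly, cumGen, PowerSeries.coeff_zero_eq_constantCoeff_apply]

/-- Coefficient `n + 1` of `cumDen κ * cumGen κ = 1`, with the terms from the constant `1` and from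
`-X` split off. The truncated subtraction `n - 1 - i` is exact because `i < n`. Only `κ m` with `m ≥
2` enters. -/
theorem cumPoly_succ (κ : ℕ → ℝ) (n : ℕ) :
    cumPoly κ (n + 1) =
      X * cumPoly κ n - ∑ i ∈ Finset.range n, C (κ (i + 2)) * cumPoly κ (n - 1 - i) := by
  have h := congrArg (PowerSeries.coeff (n + 1)) (cumDen_mul_cumGen κ)
  rw [PowerSeries.coeff_mul, Finset.Nat.sum_antidiagonal_eq_sum_range_succ_mk,
    Finset.sum_range_succ', Finset.sum_range_succ'] at h
  simp only [cumDen, PowerSeries.coeff_mk, PowerSeries.coeff_one] at h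
  have e : ∀ i ∈ Finset.range n, C (κ (i + 2)) * cumPoly κ (n - 1 - i) =
      (if i + 1 + 1 = 0 then 1 else if i + 1 + 1 = 1 then -X else C (κ (i + 1 + 1))) *
        PowerSeries.coeff (n + 1 - (i + 1 + 1)) (cumGen κ) := by
    intro i hi
    have : n + 1 - (i + 1 + 1) = n - 1 - i := by omega
    simp [this, cumPoly]
  rw [Finset.sum_congr rfl e]
  simp only [cumPoly] at h ⊢
  simp at h ⊢
  linear_combination h

theorem cumPoly_one (κ : ℕ → ℝ) : cumPoly κ 1 = X := by
  simp [cumPoly_succ, cumPoly_zero]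

theorem cumPoly_two (κ : ℕ → ℝ) : cumPoly κ 2 = X ^ 2 - C (κ 2) := by
  rw [cumPoly_succ, cumPoly_one]
  simp [cumPoly_zero]; ring

theorem cumPoly_four (κ : ℕ → ℝ) :
    cumPoly κ 4 = X ^ 4 - 3 * C (κ 2) * X ^ 2 - 2 * C (κ 3) * X + C (κ 2) ^ 2 - C (κ 4) := by
  rw [cumPoly_succ, cumPoly_succ _ 2]
  simp [Finset.sum_range_succ, cumPoly_zero, cumPoly_one, cumPoly_two]; ring

theorem cumPoly_natDegree_le (κ : ℕ → ℝ) (n : ℕ) : (cumPoly κ n).natDegree ≤ n := by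
  induction n using Nat.strong_induction_on with
  | _ n ih =>
    obtain _ | n := n
    · simp [cumPoly_zero]
    rw [cumPoly_succ]
    refine (natDegree_sub_le _ _).trans (max_le ?_ ?_)
    · refine natDegree_mul_le.trans ?_
      have := ih n (by omega)
      simp only [natDegree_X]; omega
    · refine natDegree_sum_le_of_forall_le _ _ fun i hi => ?_
      refine (natDegree_C_mul_le _ _).trans ((ih _ (by omega)).trans (by omega))

theorem cumPoly_coeff_self (κ : ℕ → ℝ) (n : ℕ) : (cumPoly κ n).coeff n = 1 := by
  induction n with
  | zero => simp [cumPoly_zero]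
  | succ n ih =>
    rw [cumPoly_succ, coeff_sub, coeff_X_mul, ih, finsetSum_coeff, Finset.sum_eq_zero, sub_zero]
    intro i hi
    rw [coeff_C_mul, coeff_eq_zero_of_natDegree_lt, mul_zero]
    exact (cumPoly_natDegree_le κ _).trans_lt (by omega)

theorem tendsto_cumPoly_coeff {ι : Type*} {l : Filter ι} {κ : ι → ℕ → ℝ} {κ₀ : ℕ → ℝ}
    (h : ∀ n, 2 ≤ n → Tendsto (fun i => κ i n) l (𝓝 (κ₀ n))) (n m : ℕ) :
    Tendsto (fun i => (cumPoly (κ i) n).coeff m) l (𝓝 ((cumPoly κ₀ n).coeff m)) := by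
  induction n using Nat.strong_induction_on generalizing m with
  | _ n ih =>
    obtain _ | n := n
    · simp [cumPoly_zero, tendsto_const_nhds]
    simp only [cumPoly_succ, coeff_sub, finsetSum_coeff, coeff_C_mul]
    refine Tendsto.sub ?_ (tendsto_finsetSum _ fun i hi =>
      (h _ (by omega)).mul (ih _ (by omega) _))
    cases m with
    | zero => simp [mul_coeff_zero, tendsto_const_nhds]
    | succ m => simpa only [coeff_X_mul] using ih n (by omega) m

theorem cumPoly_eq_sum (κ : ℕ → ℝ) (n : ℕ) :
    cumPoly κ n = X ^ n + ∑ i ∈ Finset.range n, (cumPoly κ n).coeff i • X ^ i := by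
  conv_lhs => rw [(cumPoly κ n).as_sum_range' (n + 1)
    (Nat.lt_succ_of_le (cumPoly_natDegree_le κ n))]
  rw [Finset.sum_range_succ, cumPoly_coeff_self, add_comm, monomial_one_right_eq_X_pow]
  simp only [smul_X_eq_monomial]

/-- If `D i` has free cumulants `κ i` and `D₀` has free cumulants `κ₀`, convergence of the
cumulants implies convergence of the moments. -/
theorem tendsto_of_tendsto_cumulants {ι : Type*} {l : Filter ι} {κ : ι → ℕ → ℝ} {κ₀ : ℕ → ℝ}
    (h : ∀ n, 2 ≤ n → Tendsto (fun i => κ i n) l (𝓝 (κ₀ n)))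
    {D : ι → ℝ[X] →ₗ[ℝ] ℂ} {D₀ : ℝ[X] →ₗ[ℝ] ℂ} (h1 : ∀ i, D i 1 = D₀ 1)
    (hD : ∀ i n, D i (cumPoly (κ i) (n + 1)) = 0) (hD₀ : ∀ n, D₀ (cumPoly κ₀ (n + 1)) = 0)
    (P : ℝ[X]) : Tendsto (fun i => D i P) l (𝓝 (D₀ P)) := by
  have key : ∀ n, Tendsto (fun i => D i (X ^ n)) l (𝓝 (D₀ (X ^ n))) := by
    intro n
    induction n using Nat.strong_induction_on with
    | _ n ih =>
      obtain _ | n := n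
      · simp [h1, tendsto_const_nhds]
      have e : ∀ i, D i (X ^ (n + 1)) = -∑ j ∈ Finset.range (n + 1),
          (cumPoly (κ i) (n + 1)).coeff j • D i (X ^ j) := fun i => by
        have := hD i n
        rw [cumPoly_eq_sum] at this
        simp only [map_add, map_sum, map_smul] at this
        exact eq_neg_of_add_eq_zero_left this
      have e₀ : D₀ (X ^ (n + 1)) = -∑ j ∈ Finset.range (n + 1),
          (cumPoly κ₀ (n + 1)).coeff j • D₀ (X ^ j) := by
        have := hD₀ n
        rw [cumPoly_eq_sum] at this
        simp only [map_add, map_sum, map_smul] at this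
        exact eq_neg_of_add_eq_zero_left this
      rw [e₀, funext e]
      exact (tendsto_finsetSum _ fun j hj => (tendsto_cumPoly_coeff h _ _).smul
        (ih j (Finset.mem_range.mp hj))).neg
  induction P using Polynomial.induction_on' with
  | add p q hp hq => simpa only [map_add] using hp.add hq
  | monomial n a =>
    simp only [← smul_X_eq_monomial, map_smul]
    exact (key n).const_smul a

end

noncomputable section


/-! ### Additivity of free cumulants -/

section

variable {A : Type*} [Ring A] [Algebra ℂ A]

/-- Evaluation of real polynomials at an element of `A`. -/
def evalAt (a : A) : ℝ[X] →+* A :=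
  (aeval (R := ℂ) a).toRingHom.comp (mapRingHom (algebraMap ℝ ℂ))

theorem evalAt_apply (a : A) (P : ℝ[X]) : evalAt a P = aeval a (P.map (algebraMap ℝ ℂ)) := rfl

theorem evalAt_X (a : A) : evalAt a X = a := by simp [evalAt_apply]

theorem evalAt_C (a : A) (r : ℝ) : evalAt a (C r) = algebraMap ℂ A r := by simp [evalAt_apply]

theorem evalAt_mem {B : Subalgebra ℂ A} {a : A} (ha : a ∈ B) (P : ℝ[X]) : evalAt a P ∈ B :=
  Algebra.adjoin_le (Set.singleton_subset_iff.mpr ha) (aeval_mem_adjoin_singleton ℂ a)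

end

variable {A : Type*} [Ring A] [StarRing A] [Algebra ℂ A] [StarModule ℂ A]

/-- The span of alternating products of centered elements whose first factor is in `B j`. -/
def altSpan (φ : TracialState A) {ι : Type*} (B : ι → Subalgebra ℂ A) (j : ι) : Submodule ℂ A :=
  Submodule.span ℂ {w | ∃ (m : ℕ) (i : Fin (m + 1) → ι) (x : Fin (m + 1) → A),
    (∀ k, x k ∈ B (i k)) ∧ (∀ k : Fin m, i k.castSucc ≠ i k.succ) ∧ (∀ k, φ (x k) = 0) ∧
    i 0 = j ∧ (List.ofFn x).prod = w}

variable {φ : TracialState A} {ι : Type*} {B : ι → Subalgebra ℂ A}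

theorem mem_altSpan_of_mem {j : ι} {q : A} (hq : q ∈ B j) (h0 : φ q = 0) : q ∈ altSpan φ B j :=
  Submodule.subset_span
    ⟨0, fun _ => j, fun _ => q, fun _ => hq, fun k => k.elim0, fun _ => h0, rfl, by simp⟩

theorem mul_mem_altSpan {i j : ι} (hij : j ≠ i) {q w : A} (hq : q ∈ B j) (h0 : φ q = 0)
    (hw : w ∈ altSpan φ B i) : q * w ∈ altSpan φ B j := by
  induction hw using Submodule.span_induction with
  | mem w hw =>
    obtain ⟨m, k, x, hx, hk, hc, rfl, rfl⟩ := hw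
    refine Submodule.subset_span ⟨m + 1, Fin.cons j k, Fin.cons q x, ?_, ?_, ?_, rfl, ?_⟩
    · intro l; cases l using Fin.cases <;> simp [hq, hx]
    · intro l
      cases l using Fin.cases with
      | zero => simpa using hij
      | succ l => simpa [← Fin.succ_castSucc] using hk l
    · intro l; cases l using Fin.cases <;> simp [h0, hc]
    · simp [List.ofFn_succ]
  | zero => simp
  | add w₁ w₂ _ _ h₁ h₂ => rw [mul_add]; exact add_mem h₁ h₂
  | smul c w _ h => rw [mul_smul_comm]; exact Submodule.smul_mem _ _ h

theorem map_eq_zero_of_mem_altSpan (hfree : AreFree φ B) {j : ι} {w : A}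
    (hw : w ∈ altSpan φ B j) : φ w = 0 := by
  induction hw using Submodule.span_induction with
  | mem w hw =>
    obtain ⟨m, k, x, hx, hk, hc, -, rfl⟩ := hw
    exact hfree m k x hx hk hc
  | zero => exact map_zero _
  | add w₁ w₂ _ _ h₁ h₂ =>
    have : φ (w₁ + w₂) = φ w₁ + φ w₂ := map_add _ _ _
    rw [this, h₁, h₂, add_zero]
  | smul c w _ h =>
    have : φ (c • w) = c • φ w := map_smul _ _ _
    rw [this, h, smul_zero]

/-- With `v j = 1 - cumDen (κ j)` evaluated at `x j`, the denominator for the sum is `1 - ∑ v j`,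
because both `X` and the cumulants enter linearly. Expanding its inverse in terms of the inverses `G
j` of `1 - v j` produces only alternating products of centered elements, which freeness annihilates.
-/
theorem map_evalAt_cumPoly_sum [Fintype ι] (hfree : AreFree φ B)
    {x : ι → A} (hx : ∀ j, x j ∈ B j) {κ : ι → ℕ → ℝ}
    (hκ : ∀ j n, φ (evalAt (x j) (cumPoly (κ j) (n + 1))) = 0) (n : ℕ) :
    φ (evalAt (∑ j, x j) (cumPoly (fun m => ∑ j, κ j m) (n + 1))) = 0 := by
  classical
  set s := ∑ j, x j
  set κs : ℕ → ℝ := fun m => ∑ j, κ j m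
  let v : ι → PowerSeries A := fun j => 1 - PowerSeries.map (evalAt (x j)) (cumDen (κ j))
  let G : ι → PowerSeries A := fun j => PowerSeries.map (evalAt (x j)) (cumGen (κ j))
  let W : PowerSeries A := PowerSeries.map (evalAt s) (cumGen κs)
  have hG : ∀ j, G j * (1 - v j) = 1 := fun j => by
    simp only [G, v, sub_sub_cancel]
    rw [← map_mul, mul_comm, cumDen_mul_cumGen, map_one]
  have hsum : 1 - ∑ j, v j = PowerSeries.map (evalAt s) (cumDen κs) := by
    ext m
    simp only [v, map_sub, map_sum, PowerSeries.coeff_map, cumDen, PowerSeries.coeff_mk,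
      PowerSeries.coeff_one]
    obtain _ | _ | m := m
    · simp
    · simp [evalAt_X, s]
    · simp [evalAt_C, κs]
  have hW : (1 - ∑ j, v j) * W = 1 := by
    rw [hsum, ← map_mul, cumDen_mul_cumGen, map_one]
  have hW' : W = 1 + ∑ j, v j * W := by
    rw [sub_mul, one_mul, Finset.sum_mul] at hW
    rw [← hW]; abel
  -- Since `(1 - v j) W = 1 + ∑_{i ≠ j} v i W`, left multiplication by `G j - 1` gives `v j W`
  -- again. The sum now omits the index `j`, so the products alternate.
  have hWj : ∀ j, v j * W = (G j - 1) * (1 + ∑ i ∈ Finset.univ.erase j, v i * W) := fun j => by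
    have h1 : 1 + ∑ i ∈ Finset.univ.erase j, v i * W = (1 - v j) * W := by
      have h2 := Finset.add_sum_erase Finset.univ (fun i => v i * W) (Finset.mem_univ j)
      rw [sub_mul, one_mul, eq_sub_iff_add_eq, add_assoc, add_comm _ (v j * W), h2]
      exact hW'.symm
    rw [h1, ← mul_assoc, sub_mul (G j), hG, one_mul, sub_sub_cancel]
  have hG0 : ∀ j, PowerSeries.coeff 0 (G j - 1) = 0 := fun j => by
    have : PowerSeries.coeff 0 (cumGen (κ j)) = 1 := cumPoly_zero (κ j)
    rw [map_sub, PowerSeries.coeff_map, this]; simp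
  have hGn : ∀ j a, PowerSeries.coeff a (G j - 1) ∈ B j ∧
      φ (PowerSeries.coeff a (G j - 1)) = 0 := by
    intro j a
    obtain _ | a := a
    · rw [hG0]; exact ⟨zero_mem _, map_zero _⟩
    have : PowerSeries.coeff (a + 1) (G j - 1) = evalAt (x j) (cumPoly (κ j) (a + 1)) := by
      simp [G, cumPoly, PowerSeries.coeff_one]
    rw [this]
    exact ⟨evalAt_mem (hx j) _, hκ j a⟩
  -- `G j - 1` has no constant term, so degree `m` of `v j * W` involves only lower degrees of the
  -- other `v i * W`, each multiplied on the left by a centered element of `B j`.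
  have key : ∀ m j, PowerSeries.coeff m (v j * W) ∈ altSpan φ B j := by
    intro m
    induction m using Nat.strong_induction_on with
    | _ m ih =>
      intro j
      rw [hWj, PowerSeries.coeff_mul]
      refine Submodule.sum_mem _ fun p hp => ?_
      rw [Finset.HasAntidiagonal.mem_antidiagonal] at hp
      by_cases h0 : p.1 = 0
      · rw [h0, hG0, zero_mul]; exact zero_mem _
      rw [map_add, map_sum, mul_add, Finset.mul_sum]
      refine add_mem ?_ (Submodule.sum_mem _ fun i hi => ?_)
      · rw [PowerSeries.coeff_one]
        split_ifs
        · rw [mul_one]; exact mem_altSpan_of_mem (hGn j _).1 (hGn j _).2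
        · rw [mul_zero]; exact zero_mem _
      · exact mul_mem_altSpan (Finset.ne_of_mem_erase hi).symm (hGn j _).1 (hGn j _).2
          (ih _ (by omega) i)
  have hfin : evalAt s (cumPoly κs (n + 1)) = PowerSeries.coeff (n + 1) W := by
    simp [W, cumPoly]
  have hfin' : PowerSeries.coeff (n + 1) W = ∑ j, PowerSeries.coeff (n + 1) (v j * W) := by
    conv_lhs => rw [hW']
    simp [PowerSeries.coeff_one]
  rw [hfin, hfin']
  have : φ (∑ j, PowerSeries.coeff (n + 1) (v j * W)) =
    ∑ j, φ (PowerSeries.coeff (n + 1) (v j * W)) := map_sum _ _ _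
  rw [this]
  exact Finset.sum_eq_zero fun j _ => map_eq_zero_of_mem_altSpan hfree (key _ j)

end

noncomputable section

/-! ### Free cumulants of the semicircular and the free Poisson laws -/

theorem integral_semicircular {t : ℝ} (ht : 0 < t) (g : ℝ → ℝ) :
    ∫ x, g x ∂semicircular t = ∫ x, (2 * Real.pi * t)⁻¹ * √(4 * t - x ^ 2) * g x := by
  rw [semicircular, if_neg ht.ne',
    integral_withDensity_eq_integral_toReal_smul (by fun_prop) (by simp)]
  refine integral_congr_ae (.of_forall fun x => ?_)
  simp only [smul_eq_mul]
  rw [ENNReal.toReal_ofReal (by positivity)]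

theorem integral_semicircular_scale {t : ℝ} (ht : 0 < t) (g : ℝ → ℝ) :
    ∫ x, g x ∂semicircular t = ∫ x, g (√t * x) ∂semicircular 1 := by
  rw [integral_semicircular ht, integral_semicircular one_pos]
  have hs : 0 < √t := Real.sqrt_pos.mpr ht
  have h := Measure.integral_comp_mul_left
    (fun x => (2 * Real.pi * t)⁻¹ * √(4 * t - x ^ 2) * g x) (√t)
  rw [abs_of_pos (inv_pos.mpr hs), smul_eq_mul, eq_comm, inv_mul_eq_iff_eq_mul₀ hs.ne'] at h
  rw [h, ← integral_const_mul]
  refine integral_congr_ae (.of_forall fun x => ?_)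
  have e : 4 * t - (√t * x) ^ 2 = t * (4 * 1 - x ^ 2) := by
    rw [mul_pow, Real.sq_sqrt ht.le]; ring
  simp only [e, Real.sqrt_mul ht.le]
  have h2 : √t * √t = t := Real.mul_self_sqrt ht.le
  have : √t * ((2 * Real.pi * t)⁻¹ * (√t * √(4 * 1 - x ^ 2)) * g (√t * x)) =
    (√t * √t * t⁻¹) * ((2 * Real.pi)⁻¹ * √(4 * 1 - x ^ 2) * g (√t * x)) := by
      rw [mul_inv]; ring
  rw [this, h2, mul_inv_cancel₀ ht.ne', one_mul, mul_one, mul_one]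

theorem integrable_semicircular_one (P : ℝ[X]) :
    Integrable (fun x => P.eval x) (semicircular 1) := by
  rw [semicircular, if_neg one_ne_zero, integrable_withDensity_iff (by fun_prop) (by simp)]
  refine Continuous.integrable_of_hasCompactSupport ?_ ?_
  · refine P.continuous.mul ?_
    have : (fun x : ℝ => (ENNReal.ofReal ((2 * Real.pi * 1)⁻¹ * √(4 * 1 - x ^ 2))).toReal) =
        fun x => (2 * Real.pi * 1)⁻¹ * √(4 * 1 - x ^ 2) :=
      funext fun x => ENNReal.toReal_ofReal (by positivity)
    rw [this]; fun_prop
  · refine HasCompactSupport.intro (isCompact_Icc (a := -2) (b := 2)) fun x hx => ?_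
    rw [Real.sqrt_eq_zero_of_nonpos, mul_zero, ENNReal.ofReal_zero, ENNReal.toReal_zero, mul_zero]
    by_contra! h
    exact hx ⟨by nlinarith, by nlinarith⟩

open Polynomial.Chebyshev in
-- The identity `(1 - x²) U_n = T_1 T_{n+1} - T_{n+2}` reduces this to the orthogonality of the
-- polynomials `T`.
theorem integral_U_measureT (n : ℕ) :
    ∫ x, (1 - x ^ 2) * (U ℝ n).eval x ∂measureT = if n = 0 then Real.pi / 2 else 0 := by
  have e : ∀ x : ℝ, (1 - x ^ 2) * (U ℝ n).eval x =
      (T ℝ 1).eval x * (T ℝ (n + 1 : ℕ)).eval x - (T ℝ ((n : ℤ) + 2)).eval x := fun x => by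
    have := congrArg (eval x) (one_sub_X_sq_mul_U_eq_pol_in_T ℝ n)
    simpa using this
  simp_rw [e]
  have hi : ∀ P : ℝ[X], Integrable (fun x => P.eval x) measureT := fun P =>
    integrable_measureT P.continuous.continuousOn
  rw [integral_sub (by simpa using hi (T ℝ 1 * T ℝ (n + 1 : ℕ))) (hi _),
    integral_eval_T_real_measureT_of_ne_zero (by omega), sub_zero]
  split_ifs with h
  · subst h
    exact integral_T_real_mul_self_measureT_of_ne_zero one_ne_zero
  · exact integral_eval_T_real_mul_eval_T_real_measureT_of_ne (n := 1) (by omega)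

/-- The Chebyshev polynomials `U n (x / 2)`, orthonormal for the standard semicircular law. -/
def chebS (n : ℕ) : ℝ[X] := (Chebyshev.U ℝ n).comp (C (1 / 2) * X)

theorem chebS_zero : chebS 0 = 1 := by simp [chebS]

theorem chebS_one : chebS 1 = X := by
  simp only [chebS, Nat.cast_one, Chebyshev.U_one, mul_comp, X_comp, ofNat_comp]
  rw [← mul_assoc]
  have : (2 : ℝ[X]) * C (1 / 2) = 1 := by
    rw [show (2 : ℝ[X]) = C 2 from rfl, ← C_mul]; norm_num
  rw [show ((2 : ℕ) : ℝ[X]) = 2 from rfl, this, one_mul]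

theorem chebS_add_two (n : ℕ) : chebS (n + 2) = X * chebS (n + 1) - chebS n := by
  have h : (2 : ℝ[X]) * C (1 / 2) = 1 := by
    rw [show (2 : ℝ[X]) = C 2 from rfl, ← C_mul]; norm_num
  simp only [chebS, Nat.cast_add, Nat.cast_one, Nat.cast_ofNat, Chebyshev.U_add_two, sub_comp,
    mul_comp, X_comp, ofNat_comp]
  linear_combination X * (Chebyshev.U ℝ (n + 1)).comp (C (1 / 2) * X) * h

open Polynomial.Chebyshev in
-- The weight `(1 - x²)` against the arcsine weight is `√(1 - x²)`, and the substitution `x ↦ 2 x`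
-- turns this into the semicircular density.
theorem integral_chebS (n : ℕ) :
    ∫ x, (chebS n).eval x ∂semicircular 1 = if n = 0 then 1 else 0 := by
  have h1 := integral_U_measureT n
  rw [integral_measureT, intervalIntegral.integral_of_le (by norm_num)] at h1
  have h2 : ∫ x in Set.Ioc (-1 : ℝ) 1, (1 - x ^ 2) * (U ℝ n).eval x * √(1 - x ^ 2)⁻¹ =
      ∫ x : ℝ, √(1 - x ^ 2) * (U ℝ n).eval x := by
    rw [← integral_indicator measurableSet_Ioc]
    refine integral_congr_ae (.of_forall fun x => ?_)
    by_cases hx : x ∈ Set.Ioc (-1 : ℝ) 1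
    · simp only [Set.indicator_of_mem hx]
      have h0 : 0 ≤ 1 - x ^ 2 := by nlinarith [hx.1, hx.2]
      rw [Real.sqrt_inv]
      obtain h | h := h0.eq_or_lt
      · simp [← h]
      · have : 0 < √(1 - x ^ 2) := Real.sqrt_pos.mpr h
        field_simp
        rw [Real.sq_sqrt h0]; ring
    · simp only [Set.indicator_of_notMem hx]
      rw [Real.sqrt_eq_zero_of_nonpos, zero_mul]
      by_contra! h
      exact hx ⟨by nlinarith, by nlinarith⟩
  rw [h2] at h1
  rw [integral_semicircular one_pos]
  have h3 := Measure.integral_comp_mul_left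
    (fun x => (2 * Real.pi * 1)⁻¹ * √(4 * 1 - x ^ 2) * (chebS n).eval x) 2
  have h4 : ∀ x : ℝ, (2 * Real.pi * 1)⁻¹ * √(4 * 1 - (2 * x) ^ 2) * (chebS n).eval (2 * x) =
      Real.pi⁻¹ * (√(1 - x ^ 2) * (U ℝ n).eval x) := fun x => by
    rw [show 4 * 1 - (2 * x) ^ 2 = 2 ^ 2 * (1 - x ^ 2) by ring, Real.sqrt_mul (by positivity),
      Real.sqrt_sq (by norm_num)]
    simp [chebS]; ring
  simp only [h4, integral_const_mul, h1] at h3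
  rw [show |(2 : ℝ)⁻¹| = 2⁻¹ by norm_num, smul_eq_mul] at h3
  split_ifs at h3 ⊢ with h
  · have := Real.pi_ne_zero
    field_simp at h3 ⊢
    linarith
  · linarith

instance : IsProbabilityMeasure (semicircular 1) := by
  have h := integral_chebS 0
  simp only [chebS_zero, eval_one, if_true, integral_const, smul_eq_mul, mul_one] at h
  refine ⟨?_⟩
  rw [← ENNReal.toReal_eq_one_iff]; exact h

/-- The free cumulants of the centered semicircular law of variance `t`. -/
def semicircularCumulant (t : ℝ) (n : ℕ) : ℝ := if n = 2 then t else 0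

theorem cumPoly_semicircular_add_two (t : ℝ) (n : ℕ) :
    cumPoly (semicircularCumulant t) (n + 2) =
      X * cumPoly (semicircularCumulant t) (n + 1) - C t * cumPoly (semicircularCumulant t) n := by
  rw [cumPoly_succ, Finset.sum_range_succ']
  simp [semicircularCumulant]

/-- Both sides satisfy the same three-term recursion. The formula includes `t = 0`, where it handles
the Dirac mass. -/
theorem eval_cumPoly_semicircular {t : ℝ} (ht : 0 ≤ t) (n : ℕ) (x : ℝ) :
    (cumPoly (semicircularCumulant t) n).eval (√t * x) = √t ^ n * (chebS n).eval x := by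
  induction n using Nat.twoStepInduction with
  | zero => simp [cumPoly_zero, chebS_zero]
  | one => simp [cumPoly_one, chebS_one]
  | more n h1 h2 =>
    rw [cumPoly_semicircular_add_two, chebS_add_two]
    simp only [eval_sub, eval_mul, eval_X, eval_C, h1, h2]
    linear_combination √t ^ n * eval x (chebS n) * Real.sq_sqrt ht

theorem integral_cumPoly_semicircular {t : ℝ} (ht : 0 ≤ t) (n : ℕ) :
    ∫ x, (cumPoly (semicircularCumulant t) (n + 1)).eval x ∂semicircular t = 0 := by
  obtain rfl | ht' := ht.eq_or_lt
  · have := eval_cumPoly_semicircular le_rfl (n + 1) 0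
    simp only [mul_zero, Real.sqrt_zero, ne_eq, Nat.succ_ne_zero, not_false_eq_true, zero_pow,
      zero_mul] at this
    simp [semicircular, this]
  · rw [integral_semicircular_scale ht']
    simp only [eval_cumPoly_semicircular ht, integral_const_mul, integral_chebS]
    simp

theorem integral_eval_semicircular {t : ℝ} (ht : 0 ≤ t) (P : ℝ[X]) :
    ∫ x, P.eval x ∂semicircular t = ∫ x, (P.comp (C (√t) * X)).eval x ∂semicircular 1 := by
  obtain rfl | ht' := ht.eq_or_lt
  · rw [semicircular, if_pos rfl, integral_dirac]; simp
  · rw [integral_semicircular_scale ht']; simp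

/-! ### The free Poisson law, reduced to the semicircular law. -/

/-- The moment functional of a measure that integrates polynomials. -/
def momentFunctional (ν : Measure ℝ) (h : ∀ P : ℝ[X], Integrable (fun x => P.eval x) ν) :
    ℝ[X] →ₗ[ℝ] ℝ where
  toFun P := ∫ x, P.eval x ∂ν
  map_add' P Q := by simp only [eval_add]; exact integral_add (h P) (h Q)
  map_smul' a P := by simp only [eval_smul, smul_eq_mul]; exact integral_const_mul _ _

/-- The factor `y` kills the atom at `0` and cancels the `1 / y` of the density. What remains is `r`
times the law of `1 + r + √r s`, with `s` standard semicircular. -/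
theorem integral_id_mul_freePoisson {r : ℝ} (hr : 0 ≤ r) {g : ℝ → ℝ}
    (hg : Integrable (fun y => y * g y) (freePoisson r)) :
    ∫ y, y * g y ∂freePoisson r = r * ∫ x, g (1 + r + √r * x) ∂semicircular 1 := by
  rw [freePoisson] at hg ⊢
  rw [integral_add_measure hg.left_of_add_measure hg.right_of_add_measure,
    integral_smul_measure, integral_dirac, zero_mul, smul_zero, zero_add,
    integral_withDensity_eq_integral_toReal_smul (by fun_prop) (by simp)]
  -- For `y < 0` the radicand is nonpositive, since `(y - 1 - r)² - 4 r = y² - 2 y (1 + r) + (1 -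
  -- r)²`. So `ENNReal.ofReal` truncates nothing.
  have e : (fun y : ℝ => (ENNReal.ofReal ((2 * Real.pi * y)⁻¹ *
      √(4 * r - (y - 1 - r) ^ 2))).toReal • (y * g y)) =ᵐ[volume]
      fun y => (2 * Real.pi)⁻¹ * √(4 * r - (y - 1 - r) ^ 2) * g y := by
    filter_upwards [(measure_eq_zero_iff_ae_notMem.mp (measure_singleton (0 : ℝ)))] with y hy
    have hy : y ≠ 0 := hy
    rw [ENNReal.toReal_ofReal, smul_eq_mul, mul_inv]
    · field_simp
    · obtain h | h := hy.lt_or_gt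
      · rw [Real.sqrt_eq_zero_of_nonpos, mul_zero]
        nlinarith [sq_nonneg (1 - r)]
      · positivity
  rw [integral_congr_ae e]
  obtain rfl | hr' := hr.eq_or_lt
  · rw [zero_mul]
    refine (integral_congr_ae (.of_forall fun y => ?_)).trans (integral_zero _ _)
    rw [Real.sqrt_eq_zero_of_nonpos (by nlinarith [sq_nonneg (y - 1 - 0)])]; simp
  have hs : 0 < √r := Real.sqrt_pos.mpr hr'
  have h1 := integral_add_left_eq_self (μ := (volume : Measure ℝ))
    (fun y => (2 * Real.pi)⁻¹ * √(4 * r - (y - 1 - r) ^ 2) * g y) (1 + r)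
  have h := Measure.integral_comp_mul_left (fun x =>
    (2 * Real.pi)⁻¹ * √(4 * r - (1 + r + x - 1 - r) ^ 2) * g (1 + r + x)) (√r)
  rw [abs_of_pos (inv_pos.mpr hs), smul_eq_mul, eq_comm, inv_mul_eq_iff_eq_mul₀ hs.ne', h1] at h
  rw [h, integral_semicircular one_pos, ← integral_const_mul, ← integral_const_mul]
  refine integral_congr_ae (.of_forall fun x => ?_)
  have e : 4 * r - (1 + r + √r * x - 1 - r) ^ 2 = r * (4 * 1 - x ^ 2) := by
    linear_combination - x ^ 2 * Real.sq_sqrt hr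
  simp only [e, Real.sqrt_mul hr, mul_one]
  linear_combination (2 * Real.pi)⁻¹ * √(4 - x ^ 2) * g (1 + r + √r * x) * Real.mul_self_sqrt hr

/-- Auxiliary polynomials whose semicircular means are `c ^ n` if `j = 0` and `0` otherwise. -/
def poissonAux (c s : ℝ) : ℕ → ℕ → ℝ[X]
  | 0, j => chebS j
  | n + 1, j => C c * poissonAux c s n j + C (c * s) * poissonAux c s n (j + 1)

theorem integral_poissonAux (c s : ℝ) (n j : ℕ) :
    ∫ x, (poissonAux c s n j).eval x ∂semicircular 1 = if j = 0 then c ^ n else 0 := by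
  induction n generalizing j with
  | zero => simpa [poissonAux] using integral_chebS j
  | succ n ih =>
    simp only [poissonAux, eval_add, eval_mul, eval_C]
    rw [integral_add ((integrable_semicircular_one _).const_mul _)
      ((integrable_semicircular_one _).const_mul _), integral_const_mul, integral_const_mul,
      ih, ih, if_neg (Nat.succ_ne_zero j)]
    split_ifs <;> ring

theorem poissonAux_add_two (c s : ℝ) (n j : ℕ) :
    poissonAux c s n (j + 2) = X * poissonAux c s n (j + 1) - poissonAux c s n j := by
  induction n generalizing j with
  | zero => exact chebS_add_two j
  | succ n ih => simp only [poissonAux, ih]; ring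

/-- Multiplying the denominator by `1 - c z` sums the geometric tail and leaves `(1 - c z)(1 - z X)
+ r c² z²`, whence a recursion of bounded length. -/
theorem cumPoly_geometric_add_two (r c : ℝ) (n : ℕ) :
    cumPoly (fun m => r * c ^ m) (n + 2) = C c * cumPoly (fun m => r * c ^ m) (n + 1) +
      X * (cumPoly (fun m => r * c ^ m) (n + 1) - C c * cumPoly (fun m => r * c ^ m) n) -
      C (r * c ^ 2) * cumPoly (fun m => r * c ^ m) n := by
  have h1 := cumPoly_succ (fun m => r * c ^ m) (n + 1)
  have h2 := cumPoly_succ (fun m => r * c ^ m) n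
  rw [Finset.sum_range_succ'] at h1
  have e : ∑ i ∈ Finset.range n, C (r * c ^ (i + 1 + 2)) *
        cumPoly (fun m => r * c ^ m) (n + 1 - 1 - (i + 1)) =
      C c * ∑ i ∈ Finset.range n, C (r * c ^ (i + 2)) *
        cumPoly (fun m => r * c ^ m) (n - 1 - i) := by
    rw [Finset.mul_sum]
    refine Finset.sum_congr rfl fun i _ => ?_
    rw [show n + 1 - 1 - (i + 1) = n - 1 - i by omega, ← mul_assoc, ← C_mul]
    ring_nf
  simp only [e] at h1
  simp only [zero_add, Nat.add_sub_cancel, Nat.sub_zero] at h1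
  linear_combination h1 - C c * h2

/-- With `w = √r c z / (1 - c z)`, the generating function after substitution is `(1 - c z)⁻¹ (1 - w
X + w²)⁻¹ = (1 - c z)⁻¹ ∑ chebS k * w ^ k`. Its coefficients are the binomial sums that `poissonAux`
encodes. -/
theorem cumPoly_geometric_comp {r : ℝ} (hr : 0 ≤ r) (c : ℝ) (n : ℕ) :
    (cumPoly (fun m => r * c ^ m) n).comp (C c * (1 + C (√r) * X)) = poissonAux c (√r) n 0 := by
  have hs : C (√r) ^ 2 = C r := by rw [← C_pow, Real.sq_sqrt hr]
  induction n using Nat.twoStepInduction with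
  | zero => simp [cumPoly_zero, poissonAux, chebS_zero]
  | one => simp [cumPoly_one, poissonAux, chebS_zero, chebS_one]; ring
  | more n h1 h2 =>
    rw [cumPoly_geometric_add_two]
    simp only [sub_comp, add_comp, mul_comp, C_comp, X_comp, h1, h2]
    simp only [poissonAux, poissonAux_add_two, zero_add, C_mul, C_pow]
    linear_combination C c ^ 2 * poissonAux c (√r) n 0 * hs

theorem IsLawOf.integrable {D : ℝ[X] → ℂ} {ν : Measure ℝ} (h : IsLawOf D ν) (P : ℝ[X]) :
    Integrable (fun x => P.eval x) ν := by
  obtain ⟨_, ⟨R, hR⟩, -⟩ := h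
  obtain ⟨M, hM⟩ := (isCompact_Icc (a := -R) (b := R)).exists_bound_of_continuousOn
    P.continuous.continuousOn
  refine Integrable.of_bound P.continuous.aestronglyMeasurable M ?_
  filter_upwards [hR] with x hx using hM x (abs_le.mp hx)

/-- The means of `X * q n` are known from the semicircular law. The recursion for `q` then gives the
means of the `q n` themselves, starting from the mean `r` of the law. -/
theorem IsLawOf.cumPoly_freePoisson {D : ℝ[X] → ℂ} {r : ℝ} (hr : 0 ≤ r)
    (h : IsLawOf D (freePoisson r)) (c : ℝ) (n : ℕ) :
    D ((cumPoly (fun m => r * c ^ m) (n + 1)).comp (C c * (X - C r))) = 0 := by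
  let q : ℕ → ℝ[X] := fun n => (cumPoly (fun m => r * c ^ m) n).comp (C c * (X - C r))
  have hprob := h.1
  have hX : ∀ n, ∫ y, (X * q n).eval y ∂freePoisson r = r * c ^ n := fun n => by
    have hi := h.integrable (X * q n)
    simp only [eval_mul, eval_X] at hi ⊢
    rw [integral_id_mul_freePoisson hr hi]
    have h2 : ∀ x, (q n).eval (1 + r + √r * x) = (poissonAux c (√r) n 0).eval x := fun x => by
      rw [← cumPoly_geometric_comp hr]
      simp only [q, eval_comp, eval_mul, eval_C, eval_sub, eval_X, eval_add, eval_one]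
      ring_nf
    simp only [h2, integral_poissonAux, if_true]
  have hq1 : ∫ y, (q 1).eval y ∂freePoisson r = 0 := by
    have h0 := hX 0
    simp only [q, cumPoly_zero, one_comp, mul_one, pow_zero, eval_X] at h0
    have hi : Integrable (fun y : ℝ => y) (freePoisson r) := by simpa using h.integrable X
    simp only [q, cumPoly_one, X_comp, eval_mul, eval_C, eval_sub, eval_X, integral_const_mul]
    rw [integral_sub hi (integrable_const _), h0]
    simp
  have hq : ∀ n, ∫ y, (q (n + 2)).eval y ∂freePoisson r =
      c * (1 - r) * ∫ y, (q (n + 1)).eval y ∂freePoisson r := fun n => by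
    have e : q (n + 2) = C c * q (n + 1) + C c * (X - C r) * (q (n + 1) - C c * q n) -
        C (r * c ^ 2) * q n := by
      simp only [q, cumPoly_geometric_add_two, sub_comp, add_comp, mul_comp, C_comp, X_comp]
    -- The multiples of `q n` without a factor `X` cancel, because `c² r - r c² = 0`. The two terms
    -- that carry `X` have means `c · r c ^ (n + 1)` and `c² · r c ^ n`, which also cancel.
    have e : q (n + 2) = C (c * (1 - r)) * q (n + 1) + C c * (X * q (n + 1)) -
        C (c ^ 2) * (X * q n) := by
      rw [e]; simp only [C_mul, C_pow, C_sub, C_1]; ring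
    have h1 : momentFunctional _ h.integrable (X * q (n + 1)) = r * c ^ (n + 1) := hX _
    have h2 : momentFunctional _ h.integrable (X * q n) = r * c ^ n := hX _
    change momentFunctional _ h.integrable (q (n + 2)) =
      c * (1 - r) * momentFunctional _ h.integrable (q (n + 1))
    rw [e, map_sub, map_add]
    simp only [C_mul', map_smul, h1, h2, smul_eq_mul]
    ring
  have hz : ∀ n, ∫ y, (q (n + 1)).eval y ∂freePoisson r = 0 := fun n => by
    induction n with
    | zero => exact hq1
    | succ n ih => rw [hq, ih, mul_zero]
  rw [h.2.2]
  exact_mod_cast hz n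

end

noncomputable section

variable {A : Type*} [Ring A] [StarRing A] [Algebra ℂ A] [StarModule ℂ A]

/-! ### Bounded multiplication operators -/

/-- The map `A → L²(A, φ)` as a linear map. -/
def ofAlgₗ (φ : TracialState A) : A →ₗ[ℂ] L2 φ :=
  (UniformSpace.Completion.toComplₗᵢ (𝕜 := ℂ) (E := PreL2 φ)).toLinearMap ∘ₗ
    (toPreL2 φ).toLinearMap

theorem ofAlgₗ_apply (φ : TracialState A) (a : A) : ofAlgₗ φ a = ofAlg φ a := rfl

theorem TracialState.map_add (φ : TracialState A) (a b : A) : φ (a + b) = φ a + φ b :=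
  φ.toLinearMap.map_add a b

theorem TracialState.map_sub (φ : TracialState A) (a b : A) : φ (a - b) = φ a - φ b :=
  φ.toLinearMap.map_sub a b

theorem TracialState.map_smul (φ : TracialState A) (c : ℂ) (a : A) : φ (c • a) = c * φ a :=
  φ.toLinearMap.map_smul c a

theorem norm_ofAlg_sq (φ : TracialState A) (a : A) :
    ‖ofAlg φ a‖ ^ 2 = (φ (star a * a)).re := by
  rw [← inner_ofAlg, ← inner_self_eq_norm_sq (𝕜 := ℂ)]; rfl

theorem norm_ofAlg_star (φ : TracialState A) (a : A) : ‖ofAlg φ (star a)‖ = ‖ofAlg φ a‖ := by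
  rw [← sq_eq_sq₀ (norm_nonneg _) (norm_nonneg _), norm_ofAlg_sq, norm_ofAlg_sq, star_star,
    φ.tracial']

theorem norm_map_star_mul_le (φ : TracialState A) (a b : A) :
    ‖φ (star a * b)‖ ≤ ‖ofAlg φ a‖ * ‖ofAlg φ b‖ := by
  rw [← inner_ofAlg]; exact norm_inner_le_norm _ _

variable {φ : TracialState A}

/-- A self-adjoint element with moments `φ (x ^ (2 m)) ≤ R ^ (2 m)` has operator norm at most
`R`. -/
theorem norm_mul_le_of_moments {x : A} (hx : star x = x) {R : ℝ} (hR : 0 ≤ R)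
    (h : ∀ m : ℕ, (φ (x ^ (2 * m))).re ≤ R ^ (2 * m)) (a : A) :
    ‖ofAlg φ (x * a)‖ ≤ R * ‖ofAlg φ a‖ := by
  have hxs : ∀ k : ℕ, star (x ^ k) = x ^ k := fun k => by rw [star_pow, hx]
  set u : ℕ → ℝ := fun k => ‖ofAlg φ (x ^ k * a)‖ with hu
  have hu0 : ∀ k, 0 ≤ u k := fun k => norm_nonneg _
  -- Cauchy-Schwarz makes `u` log-convex, so `u k` grows at least like `(u 1 / u 0) ^ k`.
  have hlog : ∀ k, u (k + 1) ^ 2 ≤ u k * u (k + 2) := fun k => by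
    have e : star (x ^ (k + 1) * a) * (x ^ (k + 1) * a) = star (x ^ k * a) * (x ^ (k + 2) * a) := by
      simp only [star_mul, hxs, mul_assoc]
      rw [← mul_assoc (x ^ (k + 1)), ← mul_assoc (x ^ k), ← pow_add, ← pow_add]
      ring_nf
    rw [hu, norm_ofAlg_sq, e]
    exact (Complex.re_le_norm _).trans (norm_map_star_mul_le _ _ _)
  -- The trace moves `a` next to `star a`, so Cauchy-Schwarz leaves a pure moment of order `4 k`,
  -- and growth is at most like `R ^ k`.
  have hup : ∀ k, u k ^ 2 ≤ R ^ (2 * k) * ‖ofAlg φ (a * star a)‖ := fun k => by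
    have e : φ (star (x ^ k * a) * (x ^ k * a)) = φ (star (x ^ (2 * k)) * (a * star a)) := by
      rw [star_mul, hxs, hxs, two_mul, pow_add, mul_assoc, φ.tracial']
      simp only [mul_assoc]
    rw [hu, norm_ofAlg_sq, e]
    refine (Complex.re_le_norm _).trans ((norm_map_star_mul_le _ _ _).trans ?_)
    refine mul_le_mul_of_nonneg_right ?_ (norm_nonneg _)
    rw [← sq_le_sq₀ (norm_nonneg _) (by positivity), norm_ofAlg_sq, hxs, ← pow_add, ← pow_mul]
    have := h (2 * k)
    rwa [show 2 * k + 2 * k = 2 * (2 * k) by ring, mul_comm (2 * k) 2]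
  have e0 : ‖ofAlg φ a‖ = u 0 := by simp [hu]
  have e1 : ‖ofAlg φ (x * a)‖ = u 1 := by simp [hu]
  rw [e0, e1]
  obtain h0 | h0 := (hu0 0).eq_or_lt
  · have := hlog 0
    rw [← h0, zero_mul] at this
    rw [← h0, mul_zero, pow_eq_zero_iff two_ne_zero |>.mp (le_antisymm this (sq_nonneg _))]
  set ρ := u 1 / u 0 with hρ
  have hρ0 : 0 ≤ ρ := div_nonneg (hu0 1) (hu0 0)
  have hstep : ∀ k, ρ * u k ≤ u (k + 1) := by
    intro k
    induction k with
    | zero => rw [hρ, div_mul_cancel₀ _ h0.ne']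
    | succ k ih =>
      obtain hk | hk := (hu0 k).eq_or_lt
      · have := hlog k
        rw [← hk, zero_mul] at this
        rw [pow_eq_zero_iff two_ne_zero |>.mp (le_antisymm this (sq_nonneg _)), mul_zero]
        exact hu0 _
      · refine le_of_mul_le_mul_left ?_ hk
        calc u k * (ρ * u (k + 1)) = (ρ * u k) * u (k + 1) := by ring
          _ ≤ u (k + 1) * u (k + 1) := mul_le_mul_of_nonneg_right ih (hu0 _)
          _ ≤ u k * u (k + 2) := by rw [← sq]; exact hlog k
  have hlow : ∀ k, ρ ^ k * u 0 ≤ u k := by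
    intro k
    induction k with
    | zero => simp
    | succ k ih =>
      calc ρ ^ (k + 1) * u 0 = ρ * (ρ ^ k * u 0) := by ring
        _ ≤ ρ * u k := mul_le_mul_of_nonneg_left ih hρ0
        _ ≤ u (k + 1) := hstep k
  -- If `R < ρ`, the two growth rates are incompatible: dividing by `ρ ^ (2 * k)` and letting `k →
  -- ∞` would give `u 0 = 0`.
  rw [← div_le_iff₀ h0]
  by_contra! hlt
  have hρp : 0 < ρ := hR.trans_lt hlt
  have hb : ∀ k : ℕ, u 0 ^ 2 ≤ ((R / ρ) ^ 2) ^ k * ‖ofAlg φ (a * star a)‖ := fun k => by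
    have h1 : (ρ ^ k * u 0) ^ 2 ≤ R ^ (2 * k) * ‖ofAlg φ (a * star a)‖ :=
      (pow_le_pow_left₀ (by positivity) (hlow k) 2).trans (hup k)
    rw [← pow_mul, div_pow, div_mul_eq_mul_div, le_div_iff₀ (by positivity)]
    calc u 0 ^ 2 * ρ ^ (2 * k) = (ρ ^ k * u 0) ^ 2 := by ring
      _ ≤ _ := h1
  have hlim : Tendsto (fun k : ℕ => ((R / ρ) ^ 2) ^ k * ‖ofAlg φ (a * star a)‖) atTop (𝓝 0) := by
    have h1 : (R / ρ) ^ 2 < 1 := by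
      refine pow_lt_one₀ (by positivity) ?_ two_ne_zero
      rwa [div_lt_one hρp]
    simpa using (tendsto_pow_atTop_nhds_zero_of_lt_one (by positivity) h1).mul_const
      ‖ofAlg φ (a * star a)‖
  have := ge_of_tendsto' hlim hb
  nlinarith

/-- A self-adjoint element whose quadratic form is bounded by `K` has operator norm at most
`K`. -/
theorem norm_mul_le_of_form {x : A} (hx : star x = x) {K : ℝ} (hK : 0 ≤ K)
    (h : ∀ a : A, |(φ (star a * x * a)).re| ≤ K * ‖ofAlg φ a‖ ^ 2) (a : A) :
    ‖ofAlg φ (x * a)‖ ≤ K * ‖ofAlg φ a‖ := by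
  set b := x * a with hb
  -- Polarization: subtract the forms at `a + s b` and `a - s b`. The optimal `s` is `K⁻¹`, used
  -- below.
  have key : ∀ s : ℝ, 2 * s * ‖ofAlg φ b‖ ^ 2 ≤ K * (‖ofAlg φ a‖ ^ 2 + s ^ 2 * ‖ofAlg φ b‖ ^ 2) := by
    intro s
    have h1 := (abs_le.mp (h (a + (s : ℂ) • b))).2
    have h2 := (abs_le.mp (h (a - (s : ℂ) • b))).1
    have hp : star a * x * b = star b * b := by rw [hb, star_mul, hx, mul_assoc]
    have hq : star b * x * a = star b * b := by rw [mul_assoc]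
    simp only [norm_ofAlg_sq, star_add, star_sub, star_smul, Complex.star_def, Complex.conj_ofReal,
      add_mul, sub_mul, mul_add, mul_sub, smul_mul_assoc, mul_smul_comm, φ.map_add, φ.map_sub,
      φ.map_smul, hp, hq, Complex.add_re, Complex.sub_re, Complex.re_ofReal_mul] at h1 h2 ⊢
    nlinarith
  obtain rfl | hK' := hK.eq_or_lt
  · have := key 1
    have : ‖ofAlg φ b‖ ^ 2 ≤ 0 := by linarith
    rw [zero_mul, pow_eq_zero_iff two_ne_zero |>.mp (le_antisymm this (sq_nonneg _))]
  · have := key K⁻¹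
    have e : K * (‖ofAlg φ a‖ ^ 2 + K⁻¹ ^ 2 * ‖ofAlg φ b‖ ^ 2) =
        K * ‖ofAlg φ a‖ ^ 2 + K⁻¹ * ‖ofAlg φ b‖ ^ 2 := by
      field_simp
    rw [e] at this
    have h3 : K⁻¹ * ‖ofAlg φ b‖ ^ 2 ≤ K * ‖ofAlg φ a‖ ^ 2 := by linarith
    rw [inv_mul_le_iff₀ hK'] at h3
    refine abs_le_of_sq_le_sq' ?_ (by positivity) |>.2
    linarith [mul_pow K ‖ofAlg φ a‖ 2]

theorem norm_mul_right_le {x : A} (hx : star x = x) {K : ℝ}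
    (h : ∀ a : A, ‖ofAlg φ (x * a)‖ ≤ K * ‖ofAlg φ a‖) (b : A) :
    ‖ofAlg φ (b * x)‖ ≤ K * ‖ofAlg φ b‖ := by
  rw [← norm_ofAlg_star, star_mul, hx, ← norm_ofAlg_star φ b]
  exact h _

theorem norm_mul_right_pow_le {x : A} (hx : star x = x) {K : ℝ} (hK : 0 ≤ K)
    (h : ∀ a : A, ‖ofAlg φ (x * a)‖ ≤ K * ‖ofAlg φ a‖) (b : A) (m : ℕ) :
    ‖ofAlg φ (b * x ^ m)‖ ≤ K ^ m * ‖ofAlg φ b‖ := by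
  induction m with
  | zero => simp
  | succ m ih =>
    rw [pow_succ x, ← mul_assoc, pow_succ' K, mul_assoc K]
    exact (norm_mul_right_le hx h _).trans (mul_le_mul_of_nonneg_left ih hK)

/-! ### Left multiplication by `L²` limits. -/

theorem norm_le_of_inner_le {v : L2 φ} {M : ℝ}
    (h : ∀ b : A, ‖⟪ofAlg φ b, v⟫_ℂ‖ ≤ M * ‖ofAlg φ b‖) : ‖v‖ ≤ M := by
  have h' : ∀ w : L2 φ, ‖⟪w, v⟫_ℂ‖ ≤ M * ‖w‖ := fun w => by
    refine (denseRange_ofAlg φ).induction_on w ?_ h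
    exact isClosed_le (by fun_prop) (by fun_prop)
  have := h' v
  rw [inner_self_eq_norm_sq_to_K, norm_pow] at this
  simp only [Complex.coe_algebraMap, Complex.norm_real, norm_norm] at this
  obtain h0 | h0 := (norm_nonneg v).eq_or_lt
  · rw [← h0]
    by_contra! hM
    have h1 := h 1
    have : ‖ofAlg φ (1 : A)‖ = 1 := by
      rw [← sq_eq_sq₀ (norm_nonneg _) zero_le_one, norm_ofAlg_sq]; simp [φ.map_one']
    rw [this] at h1
    linarith [norm_nonneg ⟪ofAlg φ (1 : A), v⟫_ℂ]
  · exact le_of_mul_le_mul_right (by rwa [← sq]) h0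

/-- The `L²` limit of a sequence of uniformly bounded elements is bounded. -/
theorem isBoundedElement_of_tendsto {x : ℕ → A} {ξ : L2 φ} {K : ℝ}
    (hK : ∀ n (a : A), ‖ofAlg φ (x n * a)‖ ≤ K * ‖ofAlg φ a‖)
    (hξ : Tendsto (fun n => ofAlg φ (x n)) atTop (𝓝 ξ)) : IsBoundedElement φ ξ := by
  have hbd : ∀ a b : A, ‖⟪ofAlg φ (b * star a), ξ⟫_ℂ‖ ≤ K * ‖ofAlg φ a‖ * ‖ofAlg φ b‖ := by
    intro a b
    refine le_of_tendsto' (((continuous_const.inner continuous_id).tendsto ξ).comp hξ).norm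
      fun n => ?_
    have e : ⟪ofAlg φ (b * star a), ofAlg φ (x n)⟫_ℂ = φ (star b * (x n * a)) := by
      rw [inner_ofAlg, star_mul, star_star, mul_assoc, φ.tracial', mul_assoc]
    simp only [Function.comp, id]
    rw [e, mul_comm _ ‖ofAlg φ b‖]
    exact (norm_map_star_mul_le _ _ _).trans
      (mul_le_mul_of_nonneg_left (hK n a) (norm_nonneg _))
  let ℓ : A → (PreL2 φ →L[ℂ] ℂ) := fun a => LinearMap.mkContinuous
    ((innerSL ℂ ξ).toLinearMap ∘ₗ ofAlgₗ φ ∘ₗ LinearMap.mulRight ℂ (star a) ∘ₗ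
      (toPreL2 φ).symm.toLinearMap) (K * ‖ofAlg φ a‖) (fun b => by
        have := hbd a ((toPreL2 φ).symm b)
        rw [← norm_inner_symm] at this
        simpa [ofAlgₗ_apply, ofAlg] using this)
  have hdense : DenseRange (UniformSpace.Completion.toComplL (𝕜 := ℂ) (E := PreL2 φ)) :=
    UniformSpace.Completion.denseRange_coe
  have hind : IsUniformInducing (UniformSpace.Completion.toComplL (𝕜 := ℂ) (E := PreL2 φ)) :=
    UniformSpace.Completion.isUniformInducing_coe _
  -- The Riesz vector representing `b ↦ ⟪b a*, ξ⟫`. The uniform bound `hbd` makes this functional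
  -- continuous and then makes `T₀` bounded in `a`.
  let T₀ : A → L2 φ := fun a => (InnerProductSpace.toDual ℂ (L2 φ)).symm
    ((ℓ a).extend UniformSpace.Completion.toComplL)
  have hT₀ : ∀ a b, ⟪ofAlg φ b, T₀ a⟫_ℂ = ⟪ofAlg φ (b * star a), ξ⟫_ℂ := fun a b => by
    rw [← inner_conj_symm, InnerProductSpace.toDual_symm_apply]
    have : (ℓ a).extend UniformSpace.Completion.toComplL (ofAlg φ b) = ℓ a (toPreL2 φ b) :=
      (ℓ a).extend_eq hdense hind _
    rw [this, ← inner_conj_symm]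
    rfl
  let T₁ : PreL2 φ →L[ℂ] L2 φ := LinearMap.mkContinuous
    { toFun := fun a => T₀ ((toPreL2 φ).symm a)
      map_add' := fun a b => by
        refine (denseRange_ofAlg φ).eq_of_inner_right (𝕜 := ℂ) ?_
        intro c
        rw [inner_add_right, hT₀, hT₀, hT₀, map_add, star_add, mul_add, ← ofAlgₗ_apply, map_add,
          inner_add_left]
        rfl
      map_smul' := fun r a => by
        refine (denseRange_ofAlg φ).eq_of_inner_right (𝕜 := ℂ) ?_
        intro c
        rw [RingHom.id_apply, inner_smul_right, hT₀, hT₀, map_smul, star_smul, mul_smul_comm,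
          ← ofAlgₗ_apply, map_smul, inner_smul_left, ofAlgₗ_apply]
        simp } K (fun a => norm_le_of_inner_le fun b => by
          have : ‖a‖ = ‖ofAlg φ ((toPreL2 φ).symm a)‖ := (UniformSpace.Completion.norm_coe a).symm
          rw [this]
          exact le_of_eq_of_le (congrArg norm (hT₀ _ b)) (hbd _ b))
  refine ⟨T₁.extend UniformSpace.Completion.toComplL, fun a b => ?_⟩
  have : T₁.extend UniformSpace.Completion.toComplL (ofAlg φ a) = T₁ (toPreL2 φ a) :=
    T₁.extend_eq hdense hind _
  rw [this]
  exact hT₀ a b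

/-- Convergence of powers under uniform boundedness. -/
theorem tendsto_pow_of_tendsto {x : ℕ → A} {ξ : L2 φ} {K : ℝ} (hK0 : 0 ≤ K)
    (hx : ∀ n, star (x n) = x n)
    (hK : ∀ n (a : A), ‖ofAlg φ (x n * a)‖ ≤ K * ‖ofAlg φ a‖)
    (hξ : Tendsto (fun n => ofAlg φ (x n)) atTop (𝓝 ξ)) {T : L2 φ →L[ℂ] L2 φ}
    (hT : IsLeftMul φ ξ T) (m : ℕ) :
    Tendsto (fun n => ofAlg φ (x n ^ m)) atTop (𝓝 ((T ^ m) (ofAlg φ 1))) := by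
  induction m with
  | zero => simp
  | succ m ih =>
    have h1 : Tendsto (fun n => T (ofAlg φ (x n ^ m))) atTop (𝓝 ((T ^ (m + 1)) (ofAlg φ 1))) := by
      rw [pow_succ' T]
      exact (T.continuous.tendsto _).comp ih
    -- Tested against `b`, the difference is `⟪b x_n ^ m, x_n - ξ⟫`. Right multiplication by `x_n ^
    -- m` costs `K ^ m`, because `star` is an isometry for a trace.
    have h2 : Tendsto (fun n => ofAlg φ (x n ^ (m + 1)) - T (ofAlg φ (x n ^ m))) atTop (𝓝 0) := by
      have h3 : Tendsto (fun n => K ^ m * ‖ofAlg φ (x n) - ξ‖) atTop (𝓝 0) := by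
        simpa using (tendsto_iff_norm_sub_tendsto_zero.mp hξ).const_mul (K ^ m)
      refine squeeze_zero_norm (fun n => norm_le_of_inner_le fun b => ?_) h3
      have e : ⟪ofAlg φ b, ofAlg φ (x n ^ (m + 1))⟫_ℂ =
          ⟪ofAlg φ (b * x n ^ m), ofAlg φ (x n)⟫_ℂ := by
        rw [inner_ofAlg, inner_ofAlg, star_mul, star_pow, hx, φ.tracial', pow_succ' (x n),
          mul_assoc, φ.tracial', mul_assoc]
      rw [inner_sub_right, hT, star_pow, hx, e, ← inner_sub_right]
      refine (norm_inner_le_norm _ _).trans ?_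
      rw [mul_right_comm]
      exact mul_le_mul_of_nonneg_right (norm_mul_right_pow_le (hx n) hK0 (hK n) b m)
        (norm_nonneg _)
    simpa using h1.add h2

end

noncomputable section

variable {A : Type*} [Ring A] [StarRing A] [Algebra ℂ A] [StarModule ℂ A] {φ : TracialState A}

/-! ### The Itô isometry -/

theorem IsFreePoissonMeasure.star_eq {Z : Type*} [MeasurableSpace Z] {μ : Measure Z} {N : Set Z → A}
    (hN : IsFreePoissonMeasure φ μ N) {B : Set Z} (hB : MeasurableSet B) (hμ : μ B < ⊤) :
    star (N B) = N B := by
  refine AddSubmonoid.closure_induction (motive := fun a _ => star a = a) ?_ (star_zero _) ?_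
    (hN.positive B hB hμ)
  · rintro _ ⟨a, rfl⟩; simp
  · intro a b _ _ ha hb; rw [star_add, ha, hb]

theorem IsFreePoissonMeasure.form_nonneg {Z : Type*} [MeasurableSpace Z] {μ : Measure Z}
    {N : Set Z → A} (hN : IsFreePoissonMeasure φ μ N) {B : Set Z} (hB : MeasurableSet B)
    (hμ : μ B < ⊤) (a : A) : 0 ≤ (φ (star a * N B * a)).re := by
  refine AddSubmonoid.closure_induction (motive := fun p _ => 0 ≤ (φ (star a * p * a)).re) ?_ ?_ ?_
    (hN.positive B hB hμ)
  · rintro _ ⟨y, rfl⟩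
    have : star a * (star y * y) * a = star (y * a) * (y * a) := by
      rw [star_mul]; simp only [mul_assoc]
    simp only [this]
    rw [← norm_ofAlg_sq]; positivity
  · simp
  · intro p q _ _ hp hq
    rw [mul_add, add_mul, φ.map_add, Complex.add_re]; exact add_nonneg hp hq

theorem IsFreePoissonMeasure.exists_bound {Z : Type*} [MeasurableSpace Z] {μ : Measure Z}
    {N : Set Z → A} (hN : IsFreePoissonMeasure φ μ N) {B : Set Z} (hB : MeasurableSet B)
    (hμ : μ B < ⊤) : ∃ R : ℝ, 0 ≤ R ∧ ∀ a : A, (φ (star a * N B * a)).re ≤ R * ‖ofAlg φ a‖ ^ 2 := by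
  have hl := hN.law B hB hμ
  have hi := hl.integrable
  obtain ⟨hp, ⟨R, hR⟩, hm⟩ := hl
  refine ⟨|R|, abs_nonneg R, fun a => ?_⟩
  have h1 := norm_mul_le_of_moments (φ := φ) (hN.star_eq hB hμ) (abs_nonneg R) (fun m => by
    have h2 := hm (X ^ (2 * m))
    simp only [polyMoment, Polynomial.map_pow, map_X, map_pow, aeval_X] at h2
    rw [h2, Complex.ofReal_re]
    calc ∫ x, (X ^ (2 * m) : ℝ[X]).eval x ∂freePoisson (μ B).toReal
        ≤ ∫ _, |R| ^ (2 * m) ∂freePoisson (μ B).toReal := by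
          refine integral_mono_ae (hi _) (integrable_const _) ?_
          filter_upwards [hR] with x hx
          simp only [eval_pow, eval_X]
          rw [pow_mul, pow_mul]
          exact pow_le_pow_left₀ (sq_nonneg _) (sq_le_sq.mpr
            (by rw [abs_abs]; exact hx.trans (le_abs_self R))) m
      _ = |R| ^ (2 * m) := by simp) a
  rw [mul_assoc]
  refine (Complex.re_le_norm _).trans ((norm_map_star_mul_le _ _ _).trans ?_)
  calc ‖ofAlg φ a‖ * ‖ofAlg φ (N B * a)‖ ≤ ‖ofAlg φ a‖ * (|R| * ‖ofAlg φ a‖) :=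
        mul_le_mul_of_nonneg_left h1 (norm_nonneg _)
    _ = |R| * ‖ofAlg φ a‖ ^ 2 := by ring

theorem IsFreePoissonMeasure.union {Z : Type*} [MeasurableSpace Z] {μ : Measure Z}
    {N : Set Z → A} (hN : IsFreePoissonMeasure φ μ N) {B C : Set Z} (hB : MeasurableSet B)
    (hC : MeasurableSet C) (hμB : μ B < ⊤) (hμC : μ C < ⊤) (hBC : Disjoint B C) :
    N (B ∪ C) = N B + N C := by
  have h := hN.additive 2 ![B, C] (by simp [Fin.forall_fin_two, hB, hC])
    (by simp [Fin.forall_fin_two, hμB, hμC]) (by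
      intro i j hij
      fin_cases i <;> fin_cases j <;> simp_all [disjoint_comm])
  have e : ⋃ j, (![B, C] : Fin 2 → Set Z) j = B ∪ C := by
    ext x; simp [Fin.exists_fin_two]
  rw [e] at h
  simpa using h

theorem evalAt_smul_centered {A : Type*} [Ring A] [Algebra ℂ A] {d : ℕ} {N : Set (Z d) → A}
    (B : Set (Z d)) (c : ℝ) (P : ℝ[X]) :
    evalAt ((c : ℂ) • centered N B) P =
      evalAt (N B) (P.comp (C c * (X - C (volume B).toReal))) := by
  have h : (evalAt (N B)).comp (compRingHom (C c * (X - C (volume B).toReal))) =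
      evalAt ((c : ℂ) • centered N B) := by
    refine Polynomial.ringHom_ext (fun a => ?_) ?_
    · simp [evalAt_C]
    · simp [evalAt_C, evalAt_X, centered, Algebra.smul_def]
  rw [← h]; rfl

variable {d : ℕ} {N : Set (Z d) → A}

/-- The numbers `μ(B) c ^ m`, `m ≥ 2`, are the free cumulants of `c N̂(B)`. The variance and
freeness computations below rest on this. -/
theorem map_evalAt_smul_centered (hN : IsFreePoissonMeasure φ (volume : Measure (Z d)) N)
    {B : Set (Z d)} (hB : MeasurableSet B) (hμ : volume B < ⊤) (c : ℝ) (n : ℕ) :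
    φ (evalAt ((c : ℂ) • centered N B)
      (cumPoly (fun m => (volume B).toReal * c ^ m) (n + 1))) = 0 := by
  rw [evalAt_smul_centered]
  exact (hN.law B hB hμ).cumPoly_freePoisson ENNReal.toReal_nonneg c n

theorem map_centered (hN : IsFreePoissonMeasure φ (volume : Measure (Z d)) N)
    {B : Set (Z d)} (hB : MeasurableSet B) (hμ : volume B < ⊤) : φ (centered N B) = 0 := by
  simpa [cumPoly_one, evalAt_X] using map_evalAt_smul_centered hN hB hμ 1 0

theorem map_centered_sq (hN : IsFreePoissonMeasure φ (volume : Measure (Z d)) N)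
    {B : Set (Z d)} (hB : MeasurableSet B) (hμ : volume B < ⊤) :
    φ (centered N B * centered N B) = (volume B).toReal := by
  have := map_evalAt_smul_centered hN hB hμ 1 1
  rw [cumPoly_two, _root_.map_sub, evalAt_C, map_pow, evalAt_X, φ.map_sub,
    Algebra.algebraMap_eq_smul_one, φ.map_smul, φ.map_one'] at this
  simp only [Complex.ofReal_one, one_smul, one_pow, mul_one] at this
  rw [← sq, sub_eq_zero.mp this]

theorem centered_mem {A : Type*} [Ring A] [Algebra ℂ A] {d : ℕ} (N : Set (Z d) → A)
    (B : Set (Z d)) :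
    centered N B ∈ Algebra.adjoin ℂ {N B} :=
  sub_mem (Algebra.subset_adjoin rfl) (Subalgebra.smul_mem _ (one_mem _) _)

theorem map_centered_mul_of_disjoint (hN : IsFreePoissonMeasure φ (volume : Measure (Z d)) N)
    {B C : Set (Z d)} (hB : MeasurableSet B) (hC : MeasurableSet C) (hμB : volume B < ⊤)
    (hμC : volume C < ⊤) (hBC : Disjoint B C) : φ (centered N B * centered N C) = 0 := by
  have h := hN.free 2 ![B, C] (by simp [Fin.forall_fin_two, hB, hC])
    (by simp [Fin.forall_fin_two, hμB, hμC]) (by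
      intro i j hij
      fin_cases i <;> fin_cases j <;> simp_all [disjoint_comm])
  have := h 1 id ![centered N B, centered N C] (by simp [Fin.forall_fin_two, centered_mem])
    (by simp) (by simp [Fin.forall_fin_two, map_centered hN, *])
  simpa using this

theorem centered_union (hN : IsFreePoissonMeasure φ (volume : Measure (Z d)) N)
    {B C : Set (Z d)} (hB : MeasurableSet B) (hC : MeasurableSet C) (hμB : volume B < ⊤)
    (hμC : volume C < ⊤) (hBC : Disjoint B C) :
    centered N (B ∪ C) = centered N B + centered N C := by
  simp only [centered]
  rw [hN.union hB hC hμB hμC hBC, measure_union hBC hC, ENNReal.toReal_add hμB.ne hμC.ne]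
  push_cast
  rw [add_smul]; abel

/-- Cutting `B` and `C` along `B ∩ C`, freeness removes all cross terms and leaves the variance of
the common part. This is the Itô isometry on indicators. -/
theorem map_centered_mul (hN : IsFreePoissonMeasure φ (volume : Measure (Z d)) N)
    {B C : Set (Z d)} (hB : MeasurableSet B) (hC : MeasurableSet C) (hμB : volume B < ⊤)
    (hμC : volume C < ⊤) : φ (centered N B * centered N C) = (volume (B ∩ C)).toReal := by
  have hμ : ∀ {S : Set (Z d)} (T : Set (Z d)), volume S < ⊤ → volume (S ∩ T) < ⊤ := fun T h =>
    (measure_mono Set.inter_subset_left).trans_lt h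
  have hμ' : ∀ {S : Set (Z d)} (T : Set (Z d)), volume S < ⊤ → volume (S \ T) < ⊤ := fun T h =>
    (measure_mono Set.sdiff_subset).trans_lt h
  have h1 : centered N B = centered N (B ∩ C) + centered N (B \ C) := by
    rw [← centered_union hN (hB.inter hC) (hB.diff hC) (hμ _ hμB) (hμ' _ hμB)
      Set.disjoint_sdiff_inter.symm, Set.inter_union_sdiff]
  have h2 : centered N C = centered N (B ∩ C) + centered N (C \ B) := by
    rw [Set.inter_comm, ← centered_union hN (hC.inter hB) (hC.diff hB) (hμ _ hμC) (hμ' _ hμC)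
      Set.disjoint_sdiff_inter.symm, Set.inter_union_sdiff]
  have d1 : Disjoint (B ∩ C) (C \ B) :=
    Set.disjoint_left.mpr fun x hx hx' => hx'.2 hx.1
  have d2 : Disjoint (B \ C) (B ∩ C) :=
    Set.disjoint_left.mpr fun x hx hx' => hx.2 hx'.2
  have d3 : Disjoint (B \ C) (C \ B) :=
    Set.disjoint_left.mpr fun x hx hx' => hx.2 hx'.1
  rw [h1, h2, mul_add, add_mul, add_mul]
  simp only [φ.map_add]
  rw [map_centered_sq hN (hB.inter hC) (hμ _ hμB),
    map_centered_mul_of_disjoint hN (hB.diff hC) (hB.inter hC) (hμ' _ hμB) (hμ _ hμB) d2,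
    map_centered_mul_of_disjoint hN (hB.inter hC) (hC.diff hB) (hμ _ hμB) (hμ' _ hμC) d1,
    map_centered_mul_of_disjoint hN (hB.diff hC) (hC.diff hB) (hμ' _ hμB) (hμ' _ hμC) d3]
  ring

theorem star_centered (hN : IsFreePoissonMeasure φ (volume : Measure (Z d)) N)
    {B : Set (Z d)} (hB : MeasurableSet B) (hμ : volume B < ⊤) :
    star (centered N B) = centered N B := by
  simp [centered, hN.star_eq hB hμ]

theorem inner_elementaryIntegral (hN : IsFreePoissonMeasure φ (volume : Measure (Z d)) N)
    (h h' : Elementary d) :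
    ⟪ofAlg φ (elementaryIntegral N h), ofAlg φ (elementaryIntegral N h')⟫_ℂ =
      ⟪Elementary.toLp h, Elementary.toLp h'⟫_ℂ := by
  simp only [← ofAlgₗ_apply]
  induction h using Finsupp.induction_linear with
  | zero => simp
  | add f g hf hg => simp only [_root_.map_add, inner_add_left, hf, hg]
  | single B b =>
    induction h' using Finsupp.induction_linear with
    | zero => simp
    | add f g hf hg => simp only [_root_.map_add, inner_add_right, hf, hg]
    | single C c =>
      have e : ∀ (B : BoundedBorel d) (b : ℂ),
          elementaryIntegral N (Finsupp.single B b) = b • centered N B.1 := fun B b => by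
        simp [elementaryIntegral]
      have e' : ∀ (B : BoundedBorel d) (b : ℂ), Elementary.toLp (Finsupp.single B b) =
          b • indicatorConstLp 2 B.2.1 B.2.2.measure_lt_top.ne (1 : ℂ) := fun B b => by
        simp [Elementary.toLp]
      rw [e, e, e', e', _root_.map_smul, _root_.map_smul, inner_smul_left, inner_smul_left,
        inner_smul_right, inner_smul_right, ofAlgₗ_apply, ofAlgₗ_apply, inner_ofAlg,
        star_centered hN B.2.1 B.2.2.measure_lt_top,
        map_centered_mul hN B.2.1 C.2.1 B.2.2.measure_lt_top C.2.2.measure_lt_top,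
        L2.inner_indicatorConstLp_one_indicatorConstLp_one B.2.1 C.2.1
          B.2.2.measure_lt_top.ne C.2.2.measure_lt_top.ne]
      rfl

theorem norm_elementaryIntegral (hN : IsFreePoissonMeasure φ (volume : Measure (Z d)) N)
    (h : Elementary d) :
    ‖ofAlg φ (elementaryIntegral N h)‖ = ‖Elementary.toLp h‖ := by
  rw [← sq_eq_sq₀ (norm_nonneg _) (norm_nonneg _), ← inner_self_eq_norm_sq (𝕜 := ℂ),
    ← inner_self_eq_norm_sq (𝕜 := ℂ), inner_elementaryIntegral hN]

/-- If elementary kernels approximate `f`, then the single integral of `f` is an `L²` limit. -/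
theorem tendsto_integral (hN : IsFreePoissonMeasure φ (volume : Measure (Z d)) N)
    {f : Lp ℂ 2 (volume : Measure (Z d))} {h : ℕ → Elementary d}
    (hf : Tendsto (fun n => Elementary.toLp (h n)) atTop (𝓝 f)) :
    Tendsto (fun h => ofAlg φ (elementaryIntegral N h))
        (comap (Elementary.toLp (d := d)) (𝓝 f)) (𝓝 (integral φ N f)) := by
  have hdist : ∀ h h' : Elementary d, dist (ofAlg φ (elementaryIntegral N h))
      (ofAlg φ (elementaryIntegral N h')) = dist (Elementary.toLp h) (Elementary.toLp h') :=
    fun h h' => by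
      rw [dist_eq_norm, dist_eq_norm, ← _root_.map_sub, ← norm_elementaryIntegral hN,
        _root_.map_sub, ← ofAlgₗ_apply, ← ofAlgₗ_apply, ← ofAlgₗ_apply, _root_.map_sub]
  have hc : CauchySeq fun n => ofAlg φ (elementaryIntegral N (h n)) := by
    rw [Metric.cauchySeq_iff]
    simpa only [hdist] using Metric.cauchySeq_iff.mp hf.cauchySeq
  obtain ⟨ξ, hξ⟩ := cauchySeq_tendsto_of_complete hc
  refine tendsto_nhds_limUnder ⟨ξ, ?_⟩
  -- The isometry passes to the limit, so the distance to `ξ` depends only on the distance to `f`.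
  -- This upgrades convergence along one sequence to convergence along the whole filter.
  have hd : ∀ g : Elementary d,
      dist (ofAlg φ (elementaryIntegral N g)) ξ = dist (Elementary.toLp g) f := fun g => by
    refine tendsto_nhds_unique
      ((tendsto_const_nhds (x := ofAlg φ (elementaryIntegral N g))).dist hξ) ?_
    simp only [hdist]
    exact tendsto_const_nhds.dist hf
  rw [tendsto_iff_dist_tendsto_zero]
  simp only [hd]
  exact (tendsto_iff_dist_tendsto_zero.mp tendsto_id).comp tendsto_comap

end

noncomputable section

variable {A : Type*} [Ring A] [StarRing A] [Algebra ℂ A] [StarModule ℂ A] {φ : TracialState A}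
variable {d : ℕ} {N : Set (Z d) → A}

/-! ### Integrals of real step kernels -/

/-- The elementary kernel `∑ c_j 1_{B_j}` with real coefficients. -/
def stepKernel {r : ℕ} (B : Fin r → BoundedBorel d) (c : Fin r → ℝ) : Elementary d :=
  ∑ j, Finsupp.single (B j) (c j : ℂ)

theorem elementaryIntegral_stepKernel {A : Type*} [Ring A] [Algebra ℂ A] (N : Set (Z d) → A)
    {r : ℕ} (B : Fin r → BoundedBorel d) (c : Fin r → ℝ) :
    elementaryIntegral N (stepKernel B c) = ∑ j, (c j : ℂ) • centered N (B j).1 := by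
  simp [elementaryIntegral, stepKernel]

theorem star_elementaryIntegral_stepKernel
    (hN : IsFreePoissonMeasure φ (volume : Measure (Z d)) N)
    {r : ℕ} (B : Fin r → BoundedBorel d) (c : Fin r → ℝ) :
    star (elementaryIntegral N (stepKernel B c)) = elementaryIntegral N (stepKernel B c) := by
  rw [elementaryIntegral_stepKernel, star_sum]
  refine Finset.sum_congr rfl fun j _ => ?_
  rw [star_smul, star_centered hN (B j).2.1 (B j).2.2.measure_lt_top]
  simp

theorem map_evalAt_stepKernel (hN : IsFreePoissonMeasure φ (volume : Measure (Z d)) N)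
    {r : ℕ} {B : Fin r → BoundedBorel d} (c : Fin r → ℝ)
    (hB : Pairwise fun j k => Disjoint (B j).1 (B k).1) (n : ℕ) :
    φ (evalAt (elementaryIntegral N (stepKernel B c))
      (cumPoly (fun m => ∑ j, (volume (B j).1).toReal * c j ^ m) (n + 1))) = 0 := by
  rw [elementaryIntegral_stepKernel]
  exact map_evalAt_cumPoly_sum
    (hN.free r (fun j => (B j).1) (fun j => (B j).2.1) (fun j => (B j).2.2.measure_lt_top) hB)
    (fun j => Subalgebra.smul_mem _ (centered_mem N _) _)
    (fun j n => map_evalAt_smul_centered hN (B j).2.1 (B j).2.2.measure_lt_top (c j) n) n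

/-- Positivity gives `∑ N(B j) ≤ N(S)` as quadratic forms, so coefficients bounded by `M` give a
form bounded by `M (R + μ(S))`. The bound does not depend on the number of steps, which is what the
passage to the limit needs. -/
theorem exists_bound_stepKernel (hN : IsFreePoissonMeasure φ (volume : Measure (Z d)) N)
    {S : Set (Z d)} (hS : MeasurableSet S) (hμS : volume S < ⊤) {M : ℝ} (hM : 0 ≤ M) :
    ∃ K : ℝ, 0 ≤ K ∧ ∀ (r : ℕ) (B : Fin r → BoundedBorel d) (c : Fin r → ℝ),
      (Pairwise fun j k => Disjoint (B j).1 (B k).1) → (∀ j, (B j).1 ⊆ S) → (∀ j, |c j| ≤ M) →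
      ∀ a : A, ‖ofAlg φ (elementaryIntegral N (stepKernel B c) * a)‖ ≤ K * ‖ofAlg φ a‖ := by
  obtain ⟨R, hR0, hR⟩ := hN.exists_bound hS hμS
  have hv : 0 ≤ (volume S).toReal := ENNReal.toReal_nonneg
  refine ⟨M * (R + (volume S).toReal), by positivity, fun r B c hB hBS hc => ?_⟩
  refine norm_mul_le_of_form (star_elementaryIntegral_stepKernel hN B c) (by positivity)
    fun a => ?_
  set U := ⋃ j, (B j).1 with hU
  have hUm : MeasurableSet U := MeasurableSet.iUnion fun j => (B j).2.1
  have hUS : U ⊆ S := Set.iUnion_subset hBS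
  have hμ : ∀ {T : Set (Z d)}, T ⊆ S → volume T < ⊤ := fun h => (measure_mono h).trans_lt hμS
  have hNS : N S = ∑ j, N (B j).1 + N (S \ U) := by
    rw [← hN.additive r (fun j => (B j).1) (fun j => (B j).2.1)
      (fun j => (B j).2.2.measure_lt_top) hB, ← hN.union hUm (hS.diff hUm) (hμ hUS)
      (hμ Set.sdiff_subset) Set.disjoint_sdiff_right, Set.union_sdiff_cancel hUS]
  have hvol : ∑ j, (volume (B j).1).toReal ≤ (volume S).toReal := by
    rw [← ENNReal.toReal_sum fun j _ => (B j).2.2.measure_lt_top.ne]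
    have h1 : volume U = ∑ j, volume (B j).1 := by
      rw [measure_iUnion hB fun j => (B j).2.1, tsum_fintype]
    rw [← h1]
    exact ENNReal.toReal_mono hμS.ne (measure_mono hUS)
  set q : A → ℝ := fun x => (φ (star a * x * a)).re with hq
  have hqadd : ∀ x y, q (x + y) = q x + q y := fun x y => by
    simp only [hq, mul_add, add_mul, φ.map_add, Complex.add_re]
  have hqsum : ∀ (x : Fin r → A), q (∑ j, x j) = ∑ j, q (x j) := fun x => by
    have h0 : q 0 = 0 := by simp [hq]
    exact map_sum (⟨⟨q, h0⟩, hqadd⟩ : A →+ ℝ) x Finset.univ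
  have hterm : ∀ j, q ((c j : ℂ) • centered N (B j).1) =
      c j * (q (N (B j).1) - (volume (B j).1).toReal * ‖ofAlg φ a‖ ^ 2) := fun j => by
    simp only [hq, centered, norm_ofAlg_sq, mul_sub, sub_mul, smul_sub, mul_smul_comm,
      smul_mul_assoc, φ.map_sub, φ.map_smul, mul_one, Complex.sub_re, Complex.re_ofReal_mul]
  have hpos : ∀ j, 0 ≤ q (N (B j).1) := fun j =>
    hN.form_nonneg (B j).2.1 (B j).2.2.measure_lt_top a
  have hqS : ∑ j, q (N (B j).1) ≤ R * ‖ofAlg φ a‖ ^ 2 := by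
    have h1 : q (N S) ≤ R * ‖ofAlg φ a‖ ^ 2 := hR a
    rw [hNS, hqadd, hqsum] at h1
    have h2 : 0 ≤ q (N (S \ U)) := hN.form_nonneg (hS.diff hUm) (hμ Set.sdiff_subset) a
    linarith
  change |q _| ≤ _
  rw [elementaryIntegral_stepKernel, hqsum]
  calc |∑ j, q ((c j : ℂ) • centered N (B j).1)|
      ≤ ∑ j, |q ((c j : ℂ) • centered N (B j).1)| := Finset.abs_sum_le_sum_abs _ _
    _ ≤ ∑ j, M * (q (N (B j).1) + (volume (B j).1).toReal * ‖ofAlg φ a‖ ^ 2) := by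
        refine Finset.sum_le_sum fun j _ => ?_
        rw [hterm, abs_mul]
        refine mul_le_mul (hc j) ?_ (abs_nonneg _) hM
        have h1 : 0 ≤ (volume (B j).1).toReal * ‖ofAlg φ a‖ ^ 2 :=
          mul_nonneg ENNReal.toReal_nonneg (sq_nonneg _)
        rw [abs_le]
        constructor <;> linarith [hpos j]
    _ = M * (∑ j, q (N (B j).1) + (∑ j, (volume (B j).1).toReal) * ‖ofAlg φ a‖ ^ 2) := by
        rw [← Finset.mul_sum, Finset.sum_add_distrib, Finset.sum_mul]
    _ ≤ M * (R * ‖ofAlg φ a‖ ^ 2 + (volume S).toReal * ‖ofAlg φ a‖ ^ 2) := by gcongr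
    _ = M * (R + (volume S).toReal) * ‖ofAlg φ a‖ ^ 2 := by ring

/-! ### Approximation of bounded real kernels by step kernels. -/

theorem coeFn_lp_sum {α E ι : Type*} [MeasurableSpace α] [NormedAddCommGroup E] {p : ENNReal}
    {μ : Measure α} (s : Finset ι) (f : ι → Lp E p μ) :
    (∑ i ∈ s, f i : Lp E p μ) =ᵐ[μ] fun x => ∑ i ∈ s, f i x := by
  classical
  induction s using Finset.induction_on with
  | empty => simp only [Finset.sum_empty]; exact Lp.coeFn_zero E p μ
  | insert i s hi ih =>
    rw [Finset.sum_insert hi]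
    filter_upwards [Lp.coeFn_add (f i) (∑ i ∈ s, f i), ih] with x hx hx'
    rw [hx, Pi.add_apply, hx', Finset.sum_insert hi]

theorem coeFn_toLp_stepKernel {r : ℕ} (B : Fin r → BoundedBorel d) (c : Fin r → ℝ) :
    (Elementary.toLp (stepKernel B c) : Z d → ℂ) =ᵐ[volume]
      fun x => ((∑ j, (B j).1.indicator (fun _ => c j) x : ℝ) : ℂ) := by
  have e : Elementary.toLp (stepKernel B c) = ∑ j, (c j : ℂ) •
      indicatorConstLp 2 (B j).2.1 (B j).2.2.measure_lt_top.ne (1 : ℂ) := by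
    simp [stepKernel, Elementary.toLp]
  rw [e]
  have h1 : ∀ j : Fin r, ((c j : ℂ) • indicatorConstLp 2 (B j).2.1
      (B j).2.2.measure_lt_top.ne (1 : ℂ) : Lp ℂ 2 (volume : Measure (Z d))) =ᵐ[volume]
      fun x => (((B j).1.indicator (fun _ => c j) x : ℝ) : ℂ) := fun j => by
    filter_upwards [Lp.coeFn_smul (c j : ℂ) (indicatorConstLp 2 (B j).2.1
      (B j).2.2.measure_lt_top.ne (1 : ℂ) : Lp ℂ 2 (volume : Measure (Z d))),
      indicatorConstLp_coeFn (p := 2) (hs := (B j).2.1)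
        (hμs := (B j).2.2.measure_lt_top.ne) (c := (1 : ℂ))] with x hx hx'
    rw [hx, Pi.smul_apply, hx']
    by_cases h : x ∈ (B j).1 <;> simp [h]
  filter_upwards [coeFn_lp_sum Finset.univ fun j : Fin r => ((c j : ℂ) •
    indicatorConstLp 2 (B j).2.1 (B j).2.2.measure_lt_top.ne (1 : ℂ) :
      Lp ℂ 2 (volume : Measure (Z d))), ae_all_iff.mpr h1] with x hx hx'
  rw [hx, Complex.ofReal_sum]
  exact Finset.sum_congr rfl fun j _ => hx' j

/-- A bounded real kernel has an everywhere bounded, measurable real version vanishing outside a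
ball. -/
theorem exists_real_version {f : Lp ℂ 2 (volume : Measure (Z d))} (hf : IsBoundedKernel f)
    (hs : IsMirrorSymmetric f) : ∃ (g : Z d → ℝ) (M R : ℝ), Measurable g ∧ 0 ≤ M ∧
      (∀ x, |g x| ≤ M) ∧ (∀ x, x ∉ Metric.closedBall (0 : Z d) R → g x = 0) ∧
      ∀ᵐ x, f x = (g x : ℂ) := by
  obtain ⟨⟨M, hM⟩, R, hR⟩ := hf
  have hfm : StronglyMeasurable (f : Z d → ℂ) := Lp.stronglyMeasurable f
  let g : Z d → ℝ := ({x | |(f x).re| ≤ |M|} ∩ Metric.closedBall (0 : Z d) R).indicator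
    fun x => (f x).re
  have hre : Measurable fun x => (f x).re := Complex.measurable_re.comp hfm.measurable
  refine ⟨g, |M|, R, hre.indicator ((measurableSet_le hre.abs measurable_const).inter
    Metric.isClosed_closedBall.measurableSet), abs_nonneg _, fun x => ?_, fun x hx => ?_, ?_⟩
  · by_cases h : x ∈ {x | |(f x).re| ≤ |M|} ∩ Metric.closedBall (0 : Z d) R
    · simp only [g, Set.indicator_of_mem h]; exact h.1
    · simp only [g, Set.indicator_of_notMem h, abs_zero]; exact abs_nonneg _
  · exact Set.indicator_of_notMem (fun h => hx h.2) _
  · filter_upwards [hM, hR, hs] with x h1 h2 h3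
    have h4 : ((f x).re : ℂ) = f x := Complex.conj_eq_iff_re.mp h3.symm
    by_cases h : x ∈ Metric.closedBall (0 : Z d) R
    · have : x ∈ {x | |(f x).re| ≤ |M|} ∩ Metric.closedBall (0 : Z d) R :=
        ⟨((Complex.abs_re_le_norm _).trans h1).trans (le_abs_self M), h⟩
      simp only [g, Set.indicator_of_mem this, h4]
    · have : x ∉ {x | |(f x).re| ≤ |M|} ∩ Metric.closedBall (0 : Z d) R := fun h' => h h'.2
      rw [h2 (by simpa using h)]
      simp only [g, Set.indicator_of_notMem this, Complex.ofReal_zero]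

theorem sum_stepKernel_simpleFunc (g : SimpleFunc (Z d) ℝ) {R : ℝ} :
    ∃ (r : ℕ) (B : Fin r → BoundedBorel d) (c : Fin r → ℝ),
      (Pairwise fun j k => Disjoint (B j).1 (B k).1) ∧
      (∀ j, (B j).1 ⊆ Metric.closedBall 0 R) ∧ (∀ j, ∃ x, g x = c j) ∧
      (∀ x, ∑ j, (B j).1.indicator (fun _ => c j) x =
        (Metric.closedBall 0 R).indicator g x) ∧
      ∀ m : ℕ, m ≠ 0 → ∑ j, (volume (B j).1).toReal * c j ^ m =
        ∫ x in Metric.closedBall 0 R, g x ^ m := by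
  classical
  let e := g.range.equivFin
  have hball : MeasurableSet (Metric.closedBall (0 : Z d) R) :=
    Metric.isClosed_closedBall.measurableSet
  have hsum : ∀ F : ℝ → ℝ, ∑ j, F (e.symm j).1 = ∑ y ∈ g.range, F y := fun F => by
    rw [e.symm.sum_comp (fun y => F y.1), Finset.sum_coe_sort]
  refine ⟨g.range.card, fun j => ⟨g ⁻¹' {(e.symm j).1} ∩ Metric.closedBall 0 R,
    (g.measurableSet_fiber _).inter hball, Metric.isBounded_closedBall.subset Set.inter_subset_right⟩,
    fun j => (e.symm j).1, ?_, fun j => Set.inter_subset_right, fun j => ?_, fun x => ?_,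
    fun m hm => ?_⟩
  · intro j k hjk
    refine Set.disjoint_left.mpr fun x hx hx' => hjk ?_
    have h1 : g x = (e.symm j).1 := hx.1
    have h2 : g x = (e.symm k).1 := hx'.1
    exact e.symm.injective (Subtype.ext (h1.symm.trans h2))
  · exact SimpleFunc.mem_range.mp (e.symm j).2
  · rw [hsum fun y => (g ⁻¹' {y} ∩ Metric.closedBall 0 R).indicator (fun _ => y) x]
    by_cases hx : x ∈ Metric.closedBall (0 : Z d) R
    · rw [Set.indicator_of_mem hx, Finset.sum_eq_single (g x)]
      · have h : x ∈ g ⁻¹' {g x} ∩ Metric.closedBall 0 R := ⟨rfl, hx⟩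
        exact Set.indicator_of_mem h _
      · intro y _ hy
        exact Set.indicator_of_notMem (fun h => hy (Set.mem_singleton_iff.mp h.1).symm) _
      · intro h; exact absurd (g.mem_range_self x) h
    · rw [Set.indicator_of_notMem hx]
      exact Finset.sum_eq_zero fun y _ => Set.indicator_of_notMem (fun h => hx h.2) _
  · rw [hsum fun y => (volume (g ⁻¹' {y} ∩ Metric.closedBall 0 R)).toReal * y ^ m]
    have : IsFiniteMeasure (volume.restrict (Metric.closedBall (0 : Z d) R)) :=
      ⟨by rw [Measure.restrict_apply_univ]; exact measure_closedBall_lt_top⟩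
    -- Here `m ≠ 0` ensures that `y ↦ y ^ m` vanishes at `0`.
    have h1 := SimpleFunc.map_integral (μ := volume.restrict (Metric.closedBall (0 : Z d) R)) g
      (fun y => y ^ m) (g.integrable_of_isFiniteMeasure) (by simp [hm])
    rw [SimpleFunc.integral_eq_integral _ (SimpleFunc.integrable_of_isFiniteMeasure _)] at h1
    simp only [SimpleFunc.coe_map, Function.comp] at h1
    rw [h1]
    refine Finset.sum_congr rfl fun y _ => ?_
    rw [smul_eq_mul, Measure.real, Measure.restrict_apply (g.measurableSet_fiber _)]

/-- One sequence has to serve three purposes: a common bound and support for the operator norms,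
`L²` convergence for the integral, and convergence of every power integral for the cumulants. -/
theorem exists_stepKernel_approx {f : Lp ℂ 2 (volume : Measure (Z d))} (hf : IsBoundedKernel f)
    (hs : IsMirrorSymmetric f) :
    ∃ (S : Set (Z d)) (M : ℝ) (r : ℕ → ℕ) (B : ∀ n, Fin (r n) → BoundedBorel d)
      (c : ∀ n, Fin (r n) → ℝ), MeasurableSet S ∧ volume S < ⊤ ∧ 0 ≤ M ∧
      (∀ n, Pairwise fun j k => Disjoint (B n j).1 (B n k).1) ∧ (∀ n j, (B n j).1 ⊆ S) ∧
      (∀ n j, |c n j| ≤ M) ∧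
      Tendsto (fun n => Elementary.toLp (stepKernel (B n) (c n))) atTop (𝓝 f) ∧
      ∀ m : ℕ, m ≠ 0 → Tendsto (fun n => ∑ j, (volume (B n j).1).toReal * c n j ^ m) atTop
        (𝓝 (∫ x, (f x).re ^ m)) := by
  obtain ⟨g, M, R, hg, hM, hgM, hgR, hfg⟩ := exists_real_version hf hs
  let a : ℕ → SimpleFunc (Z d) ℝ :=
    fun n => SimpleFunc.approxOn g hg Set.univ 0 (Set.mem_univ _) n
  -- The approximants are dominated by `2 |g|`. They are therefore bounded by `2 M` and vanish
  -- wherever `g` does, so cutting them off to the ball changes nothing.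
  have ha : ∀ n x, |a n x| ≤ 2 * |g x| := fun n x => by
    have := SimpleFunc.norm_approxOn_zero_le hg (Set.mem_univ (0 : ℝ)) x n
    simp only [Real.norm_eq_abs] at this
    linarith
  have hlim : ∀ x, Tendsto (fun n => a n x) atTop (𝓝 (g x)) := fun x =>
    SimpleFunc.tendsto_approxOn hg (Set.mem_univ 0) (by simp)
  choose r B c h1 h2 h3 h4 h5 using fun n => sum_stepKernel_simpleFunc (a n) (R := R)
  have hfin : volume (Metric.closedBall (0 : Z d) R) < ⊤ := measure_closedBall_lt_top
  have hball : MeasurableSet (Metric.closedBall (0 : Z d) R) :=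
    Metric.isClosed_closedBall.measurableSet
  have : IsFiniteMeasure (volume.restrict (Metric.closedBall (0 : Z d) R)) :=
    ⟨by rwa [Measure.restrict_apply_univ]⟩
  refine ⟨Metric.closedBall 0 R, 2 * M, r, B, c, hball, hfin, by positivity, h1, h2,
    fun n j => ?_, ?_, fun m hm => ?_⟩
  · obtain ⟨x, hx⟩ := h3 n j
    rw [← hx]
    exact (ha n x).trans (by linarith [hgM x])
  · rw [Lp.tendsto_Lp_iff_tendsto_eLpNorm']
    have hmem : MemLp g 2 volume := by
      have : MemLp (fun x => (f x).re) 2 volume := (Lp.memLp f).re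
      refine (memLp_congr_ae ?_).mp this
      filter_upwards [hfg] with x hx
      rw [hx, Complex.ofReal_re]
    have h6 := SimpleFunc.tendsto_approxOn_Lp_eLpNorm (p := 2) (μ := volume) hg (Set.mem_univ 0)
      (by simp) (by simp) (by simpa using hmem.2)
    refine h6.congr fun n => ?_
    refine eLpNorm_congr_norm_ae ?_
    filter_upwards [coeFn_toLp_stepKernel (B n) (c n), hfg] with x hx hx'
    rw [Pi.sub_apply, Pi.sub_apply, hx, hx', h4, ← Complex.ofReal_sub, Complex.norm_real]
    congr 2
    by_cases hxR : x ∈ Metric.closedBall (0 : Z d) R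
    · rw [Set.indicator_of_mem hxR]
    · rw [Set.indicator_of_notMem hxR]
      have := ha n x
      rw [hgR x hxR, abs_zero, mul_zero] at this
      exact abs_nonpos_iff.mp this
  · have h6 : ∫ x, (f x).re ^ m = ∫ x in Metric.closedBall (0 : Z d) R, g x ^ m := by
      rw [setIntegral_eq_integral_of_forall_compl_eq_zero fun x hx => by
        rw [hgR x hx, zero_pow hm]]
      refine integral_congr_ae ?_
      filter_upwards [hfg] with x hx
      rw [hx, Complex.ofReal_re]
    rw [h6]
    simp only [fun n => h5 n m hm]
    refine tendsto_integral_of_dominated_convergence (fun _ => (2 * M) ^ m)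
      (fun n => ((a n).measurable.pow_const m).aestronglyMeasurable) (integrable_const _)
      (fun n => .of_forall fun x => ?_) (.of_forall fun x => (hlim x).pow m)
    rw [norm_pow, Real.norm_eq_abs]
    exact pow_le_pow_left₀ (abs_nonneg _) ((ha n x).trans (by linarith [hgM x])) m

end

noncomputable section

variable {A : Type*} [Ring A] [StarRing A] [Algebra ℂ A] [StarModule ℂ A] {φ : TracialState A}
variable {d : ℕ} {N : Set (Z d) → A}

/-! ### Moments of single integrals -/

/-- The moment functional of an element of `A`. -/
def algMoments (φ : TracialState A) (x : A) : ℝ[X] →ₗ[ℝ] ℂ where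
  toFun P := φ (evalAt x P)
  map_add' P Q := by rw [_root_.map_add, φ.map_add]
  map_smul' r P := by
    rw [smul_eq_C_mul, _root_.map_mul, evalAt_C, ← Algebra.smul_def, φ.map_smul]
    simp

/-- The moment functional of an element of `L²(A, φ)`. -/
def l2Moments (φ : TracialState A) (ξ : L2 φ) : ℝ[X] →ₗ[ℝ] ℂ where
  toFun P := polyMomentL2 φ ξ P
  map_add' P Q := by
    simp only [polyMomentL2, Polynomial.map_add, _root_.map_add, add_apply,
      inner_add_right]
  map_smul' r P := by
    simp only [polyMomentL2, Polynomial.map_smul, _root_.map_smul, smul_apply,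
      inner_smul_right, RingHom.id_apply]
    simp

theorem l2Moments_apply (ξ : L2 φ) (P : ℝ[X]) : l2Moments φ ξ P = polyMomentL2 φ ξ P := rfl

theorem l2Moments_one (ξ : L2 φ) : l2Moments φ ξ 1 = 1 := by
  have : ⟪ofAlg φ (1 : A), ofAlg φ 1⟫_ℂ = 1 := by
    rw [inner_ofAlg, star_one, one_mul, φ.map_one']
  rw [l2Moments_apply, polyMomentL2, Polynomial.map_one, _root_.map_one]
  exact this

/-- The moment functional of the centered semicircular law. -/
def semicircularMoments {t : ℝ} (ht : 0 ≤ t) : ℝ[X] →ₗ[ℝ] ℂ where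
  toFun P := ((∫ x, P.eval x ∂semicircular t : ℝ) : ℂ)
  map_add' P Q := by
    rw [integral_eval_semicircular ht, integral_eval_semicircular ht,
      integral_eval_semicircular ht, add_comp]
    simp only [eval_add]
    rw [integral_add (integrable_semicircular_one _) (integrable_semicircular_one _),
      Complex.ofReal_add]
  map_smul' r P := by
    simp only [eval_smul, smul_eq_mul, integral_const_mul]
    simp

theorem semicircularMoments_one {t : ℝ} (ht : 0 ≤ t) : semicircularMoments ht 1 = 1 := by
  change ((∫ x, (1 : ℝ[X]).eval x ∂semicircular t : ℝ) : ℂ) = 1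
  rw [integral_eval_semicircular ht]; simp

theorem semicircularMoments_cumPoly {t : ℝ} (ht : 0 ≤ t) (n : ℕ) :
    semicircularMoments ht (cumPoly (semicircularCumulant t) (n + 1)) = 0 := by
  change ((∫ x, _ ∂semicircular t : ℝ) : ℂ) = 0
  rw [integral_cumPoly_semicircular ht, Complex.ofReal_zero]

theorem moment_two {D : ℝ[X] →ₗ[ℝ] ℂ} {κ : ℕ → ℝ} (h1 : D 1 = 1)
    (hD : ∀ n, D (cumPoly κ (n + 1)) = 0) : D (X ^ 2) = κ 2 := by
  have h := hD 1
  rw [cumPoly_two, _root_.map_sub, ← mul_one (C _), C_mul', _root_.map_smul, h1] at h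
  rw [sub_eq_zero.mp h]; simp

/-- The cumulant `κ 3` drops out because it multiplies the first moment, which is zero. -/
theorem moment_four {D : ℝ[X] →ₗ[ℝ] ℂ} {κ : ℕ → ℝ} (h1 : D 1 = 1)
    (hD : ∀ n, D (cumPoly κ (n + 1)) = 0) : D (X ^ 4) = 2 * (κ 2 : ℂ) ^ 2 + κ 4 := by
  have h := hD 3
  have e : cumPoly κ 4 = X ^ 4 - (3 * κ 2) • X ^ 2 - (2 * κ 3) • cumPoly κ 1 +
      (κ 2 ^ 2 - κ 4) • 1 := by
    rw [cumPoly_four, cumPoly_one]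
    simp only [smul_eq_C_mul, C_mul, C_sub, C_pow, show (C 3 : ℝ[X]) = 3 from rfl,
      show (C 2 : ℝ[X]) = 2 from rfl]
    ring
  simp only [Nat.reduceAdd] at h
  rw [e, _root_.map_add, _root_.map_sub, _root_.map_sub, _root_.map_smul, _root_.map_smul,
    _root_.map_smul, h1, moment_two h1 hD, hD 0] at h
  simp only [Complex.real_smul, Complex.ofReal_mul, Complex.ofReal_sub, Complex.ofReal_pow,
    Complex.ofReal_ofNat] at h
  linear_combination h

/-- This carries the vanishing conditions that express cumulants through a limit in which functional
and cumulants both vary. -/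
theorem tendsto_apply_cumPoly {D : ℕ → ℝ[X] →ₗ[ℝ] ℂ} {D₀ : ℝ[X] →ₗ[ℝ] ℂ}
    (hD : ∀ P, Tendsto (fun k => D k P) atTop (𝓝 (D₀ P))) {κ : ℕ → ℕ → ℝ} {κ₀ : ℕ → ℝ}
    (h : ∀ n, 2 ≤ n → Tendsto (fun k => κ k n) atTop (𝓝 (κ₀ n))) (n : ℕ) :
    Tendsto (fun k => D k (cumPoly (κ k) n)) atTop (𝓝 (D₀ (cumPoly κ₀ n))) := by
  rw [cumPoly_eq_sum κ₀]
  have e : ∀ k, D k (cumPoly (κ k) n) = D k (X ^ n) +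
      ∑ i ∈ Finset.range n, (cumPoly (κ k) n).coeff i • D k (X ^ i) := fun k => by
    conv_lhs => rw [cumPoly_eq_sum]
    simp only [_root_.map_add, map_sum, _root_.map_smul]
  simp only [e, _root_.map_add, map_sum, _root_.map_smul]
  exact (hD _).add (tendsto_finsetSum _ fun i _ => (tendsto_cumPoly_coeff h n i).smul (hD _))

theorem isLeftMul_leftMul {ξ : L2 φ} (h : IsBoundedElement φ ξ) :
    IsLeftMul φ ξ (leftMul φ ξ) := by
  rw [leftMul, dif_pos h]; exact h.choose_spec

/-- The `n`-th free cumulant `∫ f ^ n` of the single integral of a real kernel `f`. -/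
def kernelCumulant (f : Lp ℂ 2 (volume : Measure (Z d))) (n : ℕ) : ℝ := ∫ x, (f x).re ^ n

/-- Each step approximant satisfies the cumulant identities exactly. Uniform operator bounds turn
`L²` convergence into convergence of moments, and the identities survive the limit. -/
theorem integral_spec (hN : IsFreePoissonMeasure φ (volume : Measure (Z d)) N)
    {f : Lp ℂ 2 (volume : Measure (Z d))} (hf : IsBoundedKernel f) (hs : IsMirrorSymmetric f) :
    Tendsto (fun h => ofAlg φ (elementaryIntegral N h))
        (comap (Elementary.toLp (d := d)) (𝓝 f)) (𝓝 (integral φ N f)) ∧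
      IsBoundedElement φ (integral φ N f) ∧
      ∀ n, l2Moments φ (integral φ N f) (cumPoly (kernelCumulant f) (n + 1)) = 0 := by
  obtain ⟨S, M, r, B, c, hS, hμS, hM, hB, hBS, hc, hlim, hcum⟩ := exists_stepKernel_approx hf hs
  have ht := tendsto_integral hN hlim
  obtain ⟨K, hK0, hK⟩ := exists_bound_stepKernel hN hS hμS hM
  set x : ℕ → A := fun n => elementaryIntegral N (stepKernel (B n) (c n)) with hx
  have hxs : ∀ n, star (x n) = x n := fun n => star_elementaryIntegral_stepKernel hN _ _
  have hxK : ∀ n (a : A), ‖ofAlg φ (x n * a)‖ ≤ K * ‖ofAlg φ a‖ := fun n =>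
    hK _ (B n) (c n) (hB n) (hBS n) (hc n)
  have hxξ : Tendsto (fun n => ofAlg φ (x n)) atTop (𝓝 (integral φ N f)) :=
    ht.comp (tendsto_comap_iff.mpr hlim)
  have hbd := isBoundedElement_of_tendsto hxK hxξ
  refine ⟨ht, hbd, fun n => ?_⟩
  have hmom : ∀ P, Tendsto (fun k => algMoments φ (x k) P) atTop
      (𝓝 (l2Moments φ (integral φ N f) P)) := by
    intro P
    induction P using Polynomial.induction_on' with
    | add p q hp hq => simpa only [_root_.map_add] using hp.add hq
    | monomial m a =>
      simp only [← smul_X_eq_monomial, _root_.map_smul]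
      refine Tendsto.const_smul ?_ a
      have h1 := (tendsto_const_nhds (x := ofAlg φ (1 : A))).inner (𝕜 := ℂ)
        (tendsto_pow_of_tendsto hK0 hxs hxK hxξ (isLeftMul_leftMul hbd) m)
      have e1 : ∀ k, algMoments φ (x k) (X ^ m) = ⟪ofAlg φ 1, ofAlg φ (x k ^ m)⟫_ℂ := fun k => by
        rw [inner_ofAlg, star_one, one_mul]
        change φ (evalAt (x k) (X ^ m)) = _
        rw [map_pow, evalAt_X]
      have e2 : l2Moments φ (integral φ N f) (X ^ m) =
          ⟪ofAlg φ 1, (leftMul φ (integral φ N f) ^ m) (ofAlg φ 1)⟫_ℂ := by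
        simp [l2Moments_apply, polyMomentL2]
      rw [e2]
      simpa only [e1] using h1
  refine tendsto_nhds_unique (tendsto_apply_cumPoly hmom
    (κ := fun k m => ∑ j, (volume (B k j).1).toReal * c k j ^ m)
    (fun m hm => hcum m (by omega)) (n + 1)) ?_
  have : ∀ k, algMoments φ (x k)
      (cumPoly (fun m => ∑ j, (volume (B k j).1).toReal * c k j ^ m) (n + 1)) = 0 := fun k =>
    map_evalAt_stepKernel hN (c k) (hB k) n
  simp only [this]
  exact tendsto_const_nhds

/-! ### Powers of bounded real kernels -/

theorem ae_eq_ofReal_re {f : Lp ℂ 2 (volume : Measure (Z d))} (hs : IsMirrorSymmetric f) :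
    ∀ᵐ x, f x = ((f x).re : ℂ) := by
  filter_upwards [hs] with x hx using (Complex.conj_eq_iff_re.mp hx.symm).symm

theorem integrable_re_pow {f : Lp ℂ 2 (volume : Measure (Z d))} (hf : IsBoundedKernel f)
    (hs : IsMirrorSymmetric f) {m : ℕ} (hm : m ≠ 0) :
    Integrable fun x => (f x).re ^ m := by
  obtain ⟨g, M, R, hg, hM, hgM, hgR, hfg⟩ := exists_real_version hf hs
  have h1 : Integrable fun x => g x ^ m := by
    rw [← integrableOn_iff_integrable_of_support_subset (s := Metric.closedBall 0 R)]
    · refine Measure.integrableOn_of_bounded (M := M ^ m) measure_closedBall_lt_top.ne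
        (hg.pow_const m).aestronglyMeasurable (.of_forall fun x => ?_)
      rw [norm_pow, Real.norm_eq_abs]
      exact pow_le_pow_left₀ (abs_nonneg _) (hgM x) m
    · intro x hx
      by_contra h
      exact hx (by simp only [hgR x h, zero_pow hm])
  refine h1.congr ?_
  filter_upwards [hfg] with x hx
  rw [hx, Complex.ofReal_re]

theorem integral_pow_eq {f : Lp ℂ 2 (volume : Measure (Z d))} (hs : IsMirrorSymmetric f) (m : ℕ) :
    ∫ x, f x ^ m = (kernelCumulant f m : ℂ) := by
  rw [kernelCumulant, ← integral_complex_ofReal]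
  refine integral_congr_ae ?_
  filter_upwards [ae_eq_ofReal_re hs] with x hx
  rw [Complex.ofReal_pow, ← hx]

theorem integral_norm_pow_eq {f : Lp ℂ 2 (volume : Measure (Z d))} (hs : IsMirrorSymmetric f)
    (m : ℕ) : ∫ x, ‖f x‖ ^ m = ∫ x, |(f x).re| ^ m := by
  refine integral_congr_ae ?_
  filter_upwards [ae_eq_ofReal_re hs] with x hx
  conv_lhs => rw [hx, Complex.norm_real, Real.norm_eq_abs]

theorem norm_sq_eq {f : Lp ℂ 2 (volume : Measure (Z d))} (hs : IsMirrorSymmetric f) :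
    ‖f‖ ^ 2 = kernelCumulant f 2 := by
  have h1 : ((‖f‖ ^ 2 : ℝ) : ℂ) = ⟪f, f⟫_ℂ := by
    rw [inner_self_eq_norm_sq_to_K]; simp
  have h2 : ⟪f, f⟫_ℂ = (kernelCumulant f 2 : ℂ) := by
    rw [L2.inner_def, ← integral_pow_eq hs]
    refine integral_congr_ae ?_
    filter_upwards [hs] with x hx
    rw [RCLike.inner_apply, ← hx, sq]
  exact_mod_cast h1.trans h2

theorem eq_zero_of_kernelCumulant_four {f : Lp ℂ 2 (volume : Measure (Z d))}
    (hf : IsBoundedKernel f) (hs : IsMirrorSymmetric f) (h : kernelCumulant f 4 = 0) : f = 0 := by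
  have h1 := (integral_eq_zero_iff_of_nonneg (fun x => by positivity)
    (integrable_re_pow hf hs (m := 4) (by norm_num))).mp h
  rw [Lp.eq_zero_iff_ae_eq_zero]
  filter_upwards [h1, ae_eq_ofReal_re hs] with x hx hx'
  have : (f x).re = 0 := pow_eq_zero_iff (n := 4) (by norm_num) |>.mp hx
  rw [hx', this]; simp

/-- Cauchy-Schwarz applied to `|f| ^ (m + 3) = f² · |f| ^ (m + 1)`. -/
theorem abs_kernelCumulant_le {f : Lp ℂ 2 (volume : Measure (Z d))} (hf : IsBoundedKernel f)
    (hs : IsMirrorSymmetric f) (m : ℕ) :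
    |kernelCumulant f (m + 3)| ≤ √(kernelCumulant f 4) * √(∫ x, ‖f x‖ ^ (2 * m + 2)) := by
  have hm : AEStronglyMeasurable (fun x => (f x).re) volume :=
    (Lp.memLp f).re.aestronglyMeasurable
  have i1 : MemLp (fun x => (f x).re ^ 2) (ENNReal.ofReal 2) volume := by
    rw [show ENNReal.ofReal 2 = 2 by simp]
    refine (memLp_two_iff_integrable_sq (hm.pow 2)).mpr ?_
    simp only [Pi.pow_apply, ← pow_mul]
    exact integrable_re_pow hf hs (by norm_num)
  have i2 : MemLp (fun x => |(f x).re| ^ (m + 1)) (ENNReal.ofReal 2) volume := by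
    rw [show ENNReal.ofReal 2 = 2 by simp]
    refine (memLp_two_iff_integrable_sq (hm.norm.pow (m + 1))).mpr ?_
    simp only [Pi.pow_apply, Real.norm_eq_abs, ← pow_mul]
    have e : ∀ x, |(f x).re| ^ ((m + 1) * 2) = (f x).re ^ ((m + 1) * 2) := fun x =>
      Even.pow_abs ⟨m + 1, by ring⟩ _
    simp only [e]
    exact integrable_re_pow hf hs (by omega)
  have h := integral_mul_le_Lp_mul_Lq_of_nonneg (μ := (volume : Measure (Z d)))
    Real.HolderConjugate.two_two (.of_forall fun x => sq_nonneg (f x).re)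
    (.of_forall fun x => by positivity) i1 i2
  rw [← Real.sqrt_eq_rpow, ← Real.sqrt_eq_rpow] at h
  simp only [Real.rpow_two, ← pow_mul] at h
  rw [integral_norm_pow_eq hs, show 2 * m + 2 = (m + 1) * 2 by ring]
  refine le_trans ?_ h
  refine (abs_integral_le_integral_abs).trans (le_of_eq (integral_congr_ae (.of_forall fun x => ?_)))
  simp only
  rw [abs_pow, ← sq_abs, ← pow_add]
  ring_nf

end

end FreeProb

/-! ### The fourth cumulant and the two assertions. -/

theorem mainTheorem7 {d : ℕ} (hd : 1 ≤ d)
    {A : Type*} [Ring A] [StarRing A] [Algebra ℂ A] [StarModule ℂ A]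
    (φ : FreeProb.TracialState A) (N : Set (FreeProb.Z d) → A)
    (hN : FreeProb.IsFreePoissonMeasure φ (volume : Measure (FreeProb.Z d)) N) :
    -- the integrals below exist as `L²` limits and are bounded elements, so they have a law
    (∀ f : Lp ℂ 2 (volume : Measure (FreeProb.Z d)),
      FreeProb.IsBoundedKernel f → FreeProb.IsMirrorSymmetric f →
      Tendsto (fun h => FreeProb.ofAlg φ (FreeProb.elementaryIntegral N h))
        (comap (FreeProb.Elementary.toLp (d := d)) (𝓝 f)) (𝓝 (FreeProb.integral φ N f)) ∧
      FreeProb.IsBoundedElement φ (FreeProb.integral φ N f)) ∧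
    -- (i) no nonzero integral is semicircular
    (∀ f : Lp ℂ 2 (volume : Measure (FreeProb.Z d)),
      FreeProb.IsBoundedKernel f → FreeProb.IsMirrorSymmetric f → f ≠ 0 →
      ∀ t : ℝ, 0 ≤ t →
        ¬ FreeProb.IsLawOf (FreeProb.polyMomentL2 φ (FreeProb.integral φ N f))
          (FreeProb.semicircular t)) ∧
    -- (ii) characterization of semicircular limits
    (∀ (f : ℕ → Lp ℂ 2 (volume : Measure (FreeProb.Z d))) (α : ℝ),
      (∀ n, FreeProb.IsBoundedKernel (f n)) → (∀ n, FreeProb.IsMirrorSymmetric (f n)) →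
      Tendsto (fun n => ‖f n‖ ^ 2) atTop (𝓝 (α ^ 2)) →
      (∀ p : ℕ, 2 ≤ p → BddAbove (Set.range fun n => ∫ x, ‖f n x‖ ^ p)) →
      (FreeProb.ConvergesInLaw
          (fun n => FreeProb.polyMomentL2 φ (FreeProb.integral φ N (f n)))
          (FreeProb.semicircular (α ^ 2)) ↔
        Tendsto (fun n => ∫ x, f n x ^ 4) atTop (𝓝 0))) := by
  open FreeProb in
  refine ⟨fun f hf hs => ⟨(integral_spec hN hf hs).1, (integral_spec hN hf hs).2.1⟩,
    fun f hf hs hf0 t ht hlaw => ?_, fun f α hf hs hα hbdd => ?_⟩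
  · have hm := (integral_spec hN hf hs).2.2
    have h1 := l2Moments_one (integral φ N f)
    have hsc := semicircularMoments_cumPoly ht
    have hsc1 := semicircularMoments_one ht
    have e : ∀ P, l2Moments φ (integral φ N f) P = semicircularMoments ht P := hlaw.2.2
    have e2 := e (X ^ 2)
    have e4 := e (X ^ 4)
    -- Equal second moments identify `κ₂`. Equal fourth moments then leave `∫ f⁴ = κ₄ = 0`.
    rw [moment_two h1 hm, moment_two hsc1 hsc] at e2
    rw [moment_four h1 hm, moment_four hsc1 hsc, e2] at e4
    refine hf0 (eq_zero_of_kernelCumulant_four hf hs ?_)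
    have := add_left_cancel e4
    simpa [semicircularCumulant] using this
  · have hα0 : 0 ≤ α ^ 2 := sq_nonneg α
    have hm := fun n => (integral_spec hN (hf n) (hs n)).2.2
    have h1 := fun n => l2Moments_one (integral φ N (f n))
    have hsc := semicircularMoments_cumPoly hα0
    have hsc1 := semicircularMoments_one hα0
    have hκ2 : Tendsto (fun n => kernelCumulant (f n) 2) atTop (𝓝 (α ^ 2)) := by
      simpa only [norm_sq_eq (hs _)] using hα
    simp only [fun n => integral_pow_eq (hs n) 4]
    constructor
    · intro hconv
      have h4 : Tendsto (fun n => l2Moments φ (integral φ N (f n)) (X ^ 4)) atTop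
          (𝓝 (semicircularMoments hα0 (X ^ 4))) := hconv (X ^ 4)
      rw [moment_four hsc1 hsc] at h4
      simp only [fun n => moment_four (h1 n) (hm n)] at h4
      have hκ2' : Tendsto (fun n => (kernelCumulant (f n) 2 : ℂ)) atTop (𝓝 ((α ^ 2 : ℝ) : ℂ)) :=
        (Complex.continuous_ofReal.tendsto _).comp hκ2
      have := h4.sub ((hκ2'.pow 2).const_mul 2)
      simpa [semicircularCumulant] using this
    · intro h0 P
      have hκ4 : Tendsto (fun n => kernelCumulant (f n) 4) atTop (𝓝 0) := by
        simpa [Function.comp_def] using (Complex.continuous_re.tendsto _).comp h0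
      refine tendsto_of_tendsto_cumulants (κ := fun n => kernelCumulant (f n))
        (κ₀ := semicircularCumulant (α ^ 2)) (fun m hm2 => ?_)
        (D := fun n => l2Moments φ (integral φ N (f n))) (D₀ := semicircularMoments hα0)
        (fun n => (h1 n).trans hsc1.symm) hm hsc P
      obtain rfl | hm3 := hm2.eq_or_lt
      · simpa [semicircularCumulant] using hκ2
      obtain ⟨k, rfl⟩ : ∃ k, m = k + 3 := ⟨m - 3, by omega⟩
      -- The exponent of the second Cauchy-Schwarz factor for the cumulant of order `k + 3`. It is
      -- at least `2`, so the uniform bound applies.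
      obtain ⟨M, hM⟩ := hbdd (2 * k + 2) (by omega)
      have h3 : Tendsto (fun n => √(kernelCumulant (f n) 4) * √M) atTop (𝓝 0) := by
        simpa using ((Real.continuous_sqrt.tendsto 0).comp hκ4).mul_const √M
      rw [semicircularCumulant, if_neg (by omega)]
      refine squeeze_zero_norm (fun n => ?_) h3
      refine (abs_kernelCumulant_le (hf n) (hs n) k).trans ?_
      exact mul_le_mul_of_nonneg_left (Real.sqrt_le_sqrt (hM ⟨n, rfl⟩)) (Real.sqrt_nonneg _)
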